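/- Let $k\ge 1$ and $P>0$. For $i=1,\dots,k$ consider the fading channel $y_i=\sqrt{snr}\,h_i\sqrt{p_i}\,x_i+n_i$, where $x_i,h_i,n_i$ are independent (also across the sub-channels), $n_i\sim\mathcal{CN}(0,1)$, $h_i\sim\mathcal{CN}(\mu_i,2\sigma_i^2)$ with $\mu_i\in\mathbb{C}$ and $\sigma_i>0$ (Rayleigh fading if $\mu_i=0$, Ricean fading if $\mu_i\ne 0$), and $x_i$ is an arbitrary complex discrete input with finite support; at least one of the inputs is not almost surely constant. The receiver knows the $h_i$. For input $x_i$ and $n\sim\mathcal{CN}(0,1)$ independent of $x_i$ and of $h_i$, let $mmse_i(s)=E|x_i-E[x_i\mid\sqrt{s}\,x_i+n]|^2$ be the canonical MMSE and let $M[mmse_i;2]=\int_0^\infty t\,mmse_i(t)\,dt$. Let $\overline{I}_i(s)=E_h\{I(x_i;\sqrt{s}\,h x_i+n)\}$ and $\overline{mmse}_i(s)=E_h\{E|hx_i-E[hx_i\mid \sqrt{s}\,hx_i+n]|^2\}$, where $h\sim\mathcal{CN}(\mu_i,2\sigma_i^2)$, the mutual information (in nats) and the inner expectations are taken for a fixed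 value of $h$, and $E_h$ averages over $h$. A power allocation $p=(p_1,\dots,p_k)$ is optimal at $snr$ if it maximizes the constrained capacity $\sum_{i=1}^k\overline{I}_i(snr\cdot p_i)$ subject to $p_i\ge 0$ for all $i$ and $\sum_{i=1}^k p_i\le P$. Then the integrals $M[mmse_i;2]$ converge and an optimal allocation exists for every $snr>0$. If $p^*(snr)$ is an optimal allocation for all large $snr$, then $\sum_{i=1}^k p_i^*(snr)=P$ for all large $snr$, and $$p_i^*(snr)=\sqrt{\exp\left(-\frac{|\mu_i|^2}{2\sigma_i^2}\right)\cdot\frac{M[mmse_i;2]}{2\sigma_i^2}\cdot\frac{1}{\lambda\, snr}}+O\left(\frac{1}{snr}\right),\qquad snr\to+\infty,\quad i=1,\dots,k,$$ where $\lambda=\lambda(snr)>0$ enforces the power constraint. This holds in both of the following senses: (a) for a $\lambda(snr)>0$, defined for all $snr>0$, such that the leading terms on the right-hand side sum to exactly $P$ for every $snr>0$; (b) for a $\lambda(snr)$ that for all large $snr$ is positive and is a Lagrange multiplier of the power constraint at $p^*(snr)$, that is, $snr\,\overline{mmse}_i(snr\,p_i^*(snr))\le\lambda(snr)$ for every $i$,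 with equality whenever $p_i^*(snr)>0$. -/

import Mathlib

open MeasureTheory ProbabilityTheory Filter Asymptotics
open scoped NNReal ENNReal Topology

noncomputable section

namespace FadingChannel

/-- The law `CN(μ, v)` of a circularly symmetric complex Gaussian variable with mean `μ` and
variance `v = E|z - μ|²`: the real and imaginary parts are independent real Gaussian variables,
each of variance `v / 2`. -/
def complexGaussian (μ : ℂ) (v : ℝ≥0) : Measure ℂ :=
  ((gaussianReal μ.re (v / 2)).prod (gaussianReal μ.im (v / 2))).map
    Complex.measurableEquivRealProd.symm

instance (μ : ℂ) (v : ℝ≥0) : IsProbabilityMeasure (complexGaussian μ v) :=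
  Measure.isProbabilityMeasure_map Complex.measurableEquivRealProd.symm.measurable.aemeasurable

/-- The law of the pair `(x, n)`: the input `x` has law `X`, the noise `n` is standard complex
Gaussian, and the two are independent. -/
def inputNoise (X : Measure ℂ) : Measure (ℂ × ℂ) :=
  X.prod (complexGaussian 0 1)

/-- The channel output `y = √snr h x + n`, as a function of the pair `(x, n)`. -/
def output (h : ℂ) (snr : ℝ) (ω : ℂ × ℂ) : ℂ :=
  (Real.sqrt snr : ℂ) * h * ω.1 + ω.2

/-- The joint law of the input and the output, given the channel gain `h`. -/
def jointLaw (X : Measure ℂ) (h : ℂ) (snr : ℝ) : Measure (ℂ × ℂ) :=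
  (inputNoise X).map (fun ω => (ω.1, output h snr ω))

/-- The conditional mutual information `I_h(snr)` between the input and the output given the
channel gain `h`, in nats: the Kullback-Leibler divergence of the joint law from the product of
its marginals, that is, the expectation of the logarithm of the density of the former with respect
to the latter. -/
def condMutualInfo (X : Measure ℂ) (h : ℂ) (snr : ℝ) : ℝ≥0∞ :=
  InformationTheory.klDiv (jointLaw X h snr) ((jointLaw X h snr).fst.prod (jointLaw X h snr).snd)

/-- The conditional MMSE `mmse_h(snr) = E|h x - E[h x | y]|²` given the channel gain `h`. -/
def condMmse (X : Measure ℂ) (h : ℂ) (snr : ℝ) : ℝ :=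
  ∫ ω, ‖h * ω.1 - ((inputNoise X)[fun ω' : ℂ × ℂ => h * ω'.1 |
    MeasurableSpace.comap (output h snr) inferInstance]) ω‖ ^ 2 ∂(inputNoise X)

/-- The canonical MMSE: the MMSE of the channel `y = √snr x + n`. -/
def mmse (X : Measure ℂ) (snr : ℝ) : ℝ := condMmse X 1 snr

/-- The average mutual information `E_h[I_h(snr)]`, for a channel gain `h` of law `H`. -/
def avgMutualInfo (X H : Measure ℂ) (snr : ℝ) : ℝ≥0∞ :=
  ∫⁻ h, condMutualInfo X h snr ∂H

/-- The average MMSE `E_h[mmse_h(snr)]`, for a channel gain `h` of law `H`. -/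
def avgMmse (X H : Measure ℂ) (snr : ℝ) : ℝ :=
  ∫ h, condMmse X h snr ∂H

/-- The Mellin transform `M[mmse; 2] = ∫_0^∞ t mmse(t) dt` of the canonical MMSE at `2`. -/
def mellinMmseTwo (X : Measure ℂ) : ℝ :=
  (mellin (fun t => (mmse X t : ℂ)) 2).re

/-- The power allocations that satisfy the total power constraint `P`. -/
def feasibleSet (k : ℕ) (P : ℝ) : Set (Fin k → ℝ) :=
  {p | (∀ i, 0 ≤ p i) ∧ ∑ i, p i ≤ P}

/-- The constrained capacity of the bank of `k` channels `y_i = √snr h_i √p_i x_i + n_i`. -/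
def capacity {k : ℕ} (X H : Fin k → Measure ℂ) (snr : ℝ) (p : Fin k → ℝ) : ℝ≥0∞ :=
  ∑ i, avgMutualInfo (X i) (H i) (snr * p i)

/-- `p` maximizes the constrained capacity under the total power constraint `P`. -/
def IsOptimalAllocation {k : ℕ} (X H : Fin k → Measure ℂ) (P snr : ℝ) (p : Fin k → ℝ) : Prop :=
  p ∈ feasibleSet k P ∧ IsMaxOn (capacity X H snr) (feasibleSet k P) p

/-- `lam` is a Lagrange multiplier of the total power constraint at the allocation `p`: the
derivative `snr · avgMmse_i(snr p_i)` of the constrained capacity in `p_i` is at most `lam`, with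
equality where `p_i > 0`. -/
def IsPowerMultiplier {k : ℕ} (X H : Fin k → Measure ℂ) (snr : ℝ) (p : Fin k → ℝ) (lam : ℝ) :
    Prop :=
  ∀ i, snr * avgMmse (X i) (H i) (snr * p i) ≤ lam ∧
    (0 < p i → snr * avgMmse (X i) (H i) (snr * p i) = lam)

/-- The leading term of the power of a channel with input law `X` and gain `CN(μ, 2σ²)`. -/
def leadingPower (X : Measure ℂ) (μ : ℂ) (σ : ℝ≥0) (lam snr : ℝ) : ℝ :=
  Real.sqrt (Real.exp (-(‖μ‖ ^ 2 / (2 * (σ : ℝ) ^ 2))) *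
    (mellinMmseTwo X / (2 * (σ : ℝ) ^ 2)) * (1 / (lam * snr)))

end FadingChannel

end

/-! Everything rests on the expansion `s² avgMmse(s) = A + O(1/s)` with `A = exp(-|μ|²/2σ²)
M[mmse;2] / 2σ²`. For a finite constellation the MMSE at gain `h` is `|h|² m(√s h)`, where `m`
(`mmseFun`) is continuous, depends only on the modulus, and decays like a Gaussian. With `f` the
density of the gain, the substitution `u = √s h` gives `s² avgMmse(s) = ∫ f(u/√s) |u|² m(u) du`.
Since `m` is even, only the even part of `f` matters; it has no linear term at `0`, so the error is
`O(1/s)` and not `O(1/√s)`. The limit `f(0) ∫ |u|² m(u) du` equals `A` in polar coordinates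
(`exists_abs_sq_mul_avgMmse_sub_le`).

The I-MMSE relation (`hasDerivAt_infoFun`, `avgMutualInfo_eq`) makes the capacity a separable sum of
integrals of `avgMmse`. Optimal allocations exist by compactness, and moving power between two
channels yields the first-order conditions without any concavity. A channel with nonconstant input
keeps power at least some `δ > 0` as `snr → ∞` (`exists_le_apply_of_isOptimal`), so the expansion
applies at `s = snr p_i` and reads `p_i² λ snr = A_i + O(1/snr)`; taking square roots gives sense
(b) (`isBigO_sub_sqrt_multiplier`). Summing over the channels eliminates `λ` and gives sense (a)
(`isBigO_sub_sqrt_normalized`). -/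

noncomputable section

namespace FadingChannel

/-! ### The density of a circularly symmetric complex Gaussian variable -/

/-- The density of the law `CN(μ, v)`. -/
def gaussDensity (μ : ℂ) (v : ℝ) (z : ℂ) : ℝ := (Real.pi * v)⁻¹ * Real.exp (-(‖z - μ‖ ^ 2 / v))

theorem gaussDensity_pos {v : ℝ} (hv : 0 < v) (μ z : ℂ) : 0 < gaussDensity μ v z := by
  unfold gaussDensity; positivity

@[fun_prop]
theorem continuous_gaussDensity (μ : ℂ) (v : ℝ) : Continuous (gaussDensity μ v) := by
  unfold gaussDensity; fun_prop

theorem complexGaussian_eq_withDensity (μ : ℂ) {v : ℝ≥0} (hv : 0 < v) :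
    complexGaussian μ v = volume.withDensity (fun z => ENNReal.ofReal (gaussDensity μ v z)) := by
  have hv2 : v / 2 ≠ 0 := (half_pos hv).ne'
  have hv' : (0 : ℝ) < v := hv
  rw [complexGaussian, gaussianReal_of_var_ne_zero _ hv2, gaussianReal_of_var_ne_zero _ hv2,
    prod_withDensity (measurable_gaussianPDF _ _) (measurable_gaussianPDF _ _)]
  ext s hs
  rw [Measure.map_apply Complex.measurableEquivRealProd.symm.measurable hs,
    withDensity_apply _ (Complex.measurableEquivRealProd.symm.measurable hs),
    withDensity_apply _ hs, ← Measure.volume_eq_prod,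
    ← Complex.volume_preserving_equiv_real_prod.setLIntegral_comp_preimage_emb
      Complex.measurableEquivRealProd.measurableEmbedding]
  have : (⇑Complex.measurableEquivRealProd ⁻¹'
      (⇑Complex.measurableEquivRealProd.symm ⁻¹' s)) = s := by
    ext z; simp
  rw [this]
  refine lintegral_congr fun z => ?_
  rw [Complex.measurableEquivRealProd_apply]
  simp only [gaussianPDF]
  rw [← ENNReal.ofReal_mul (gaussianPDFReal_nonneg _ _ _)]
  congr 1
  have h2 : √(2 * Real.pi * ((v / 2 : ℝ≥0) : ℝ)) * √(2 * Real.pi * ((v / 2 : ℝ≥0) : ℝ))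
      = Real.pi * v := by
    rw [Real.mul_self_sqrt (by positivity)]; push_cast; ring
  unfold gaussianPDFReal gaussDensity
  rw [mul_mul_mul_comm, ← mul_inv, h2, ← Real.exp_add, Complex.sq_norm, Complex.normSq_apply]
  congr 2
  push_cast
  simp only [Complex.sub_re, Complex.sub_im]
  field_simp
  ring

theorem integral_complexGaussian {E : Type*} [NormedAddCommGroup E] [NormedSpace ℝ E]
    (μ : ℂ) {v : ℝ≥0} (hv : 0 < v) (f : ℂ → E) :
    ∫ z, f z ∂(complexGaussian μ v) = ∫ z, gaussDensity μ v z • f z := by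
  rw [complexGaussian_eq_withDensity μ hv, integral_withDensity_eq_integral_toReal_smul
    (by fun_prop) (by simp)]
  simp_rw [ENNReal.toReal_ofReal (gaussDensity_pos (show (0 : ℝ) < v from hv) μ _).le]

theorem integrable_complexGaussian_iff {E : Type*} [NormedAddCommGroup E] [NormedSpace ℝ E]
    (μ : ℂ) {v : ℝ≥0} (hv : 0 < v) (f : ℂ → E) :
    Integrable f (complexGaussian μ v) ↔ Integrable (fun z => gaussDensity μ v z • f z) := by
  rw [complexGaussian_eq_withDensity μ hv, integrable_withDensity_iff_integrable_smul'
    (by fun_prop) (by simp)]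
  simp_rw [ENNReal.toReal_ofReal (gaussDensity_pos (show (0 : ℝ) < v from hv) μ _).le]

theorem integrable_norm_pow_mul_exp_neg_mul_sq (k : ℕ) {b : ℝ} (hb : 0 < b) :
    Integrable (fun z : ℂ => ‖z‖ ^ k * Real.exp (-b * ‖z‖ ^ 2)) := by
  have h := (integrable_fun_norm_addHaar (volume : Measure ℂ)
    (f := fun r : ℝ => r ^ k * Real.exp (-b * r ^ 2))).2 ?_
  · exact h
  · have := integrableOn_rpow_mul_exp_neg_mul_sq hb (s := ((k + 1 : ℕ) : ℝ))
      (lt_of_lt_of_le (by norm_num) (Nat.cast_nonneg (k + 1)))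
    refine this.congr_fun (fun r _ => ?_) measurableSet_Ioi
    simp only [Complex.finrank_real_complex, smul_eq_mul, Real.rpow_natCast]
    ring

/-- The density of the standard complex Gaussian law. -/
def stdDensity (z : ℂ) : ℝ := Real.pi⁻¹ * Real.exp (-‖z‖ ^ 2)

theorem gaussDensity_zero_one : gaussDensity 0 1 = stdDensity := by
  ext z; simp [gaussDensity, stdDensity]

theorem stdDensity_pos (z : ℂ) : 0 < stdDensity z := by unfold stdDensity; positivity

@[fun_prop]
theorem continuous_stdDensity : Continuous stdDensity := by unfold stdDensity; fun_prop

theorem stdDensity_norm_mul {u : ℂ} (hu : ‖u‖ = 1) (z : ℂ) :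
    stdDensity (u * z) = stdDensity z := by
  simp [stdDensity, hu]

theorem integral_stdNoise {E : Type*} [NormedAddCommGroup E] [NormedSpace ℝ E] (f : ℂ → E) :
    ∫ z, f z ∂(complexGaussian 0 1) = ∫ z, stdDensity z • f z := by
  rw [integral_complexGaussian 0 one_pos, ← gaussDensity_zero_one]; rfl

theorem integrable_stdNoise_iff {E : Type*} [NormedAddCommGroup E] [NormedSpace ℝ E] (f : ℂ → E) :
    Integrable f (complexGaussian 0 1) ↔ Integrable (fun z => stdDensity z • f z) := by
  rw [integrable_complexGaussian_iff 0 one_pos, ← gaussDensity_zero_one]; rfl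

theorem stdNoise_eq_withDensity :
    complexGaussian 0 1 = volume.withDensity (fun z => ENNReal.ofReal (stdDensity z)) := by
  rw [complexGaussian_eq_withDensity 0 one_pos, ← gaussDensity_zero_one]; rfl

theorem integrable_stdDensity_mul_norm_pow (k : ℕ) :
    Integrable (fun z => stdDensity z * ‖z‖ ^ k) := by
  refine ((integrable_norm_pow_mul_exp_neg_mul_sq k one_pos).const_mul Real.pi⁻¹).congr
    (.of_forall fun z => ?_)
  simp only [stdDensity, neg_mul, one_mul]
  ring

theorem integrable_stdDensity : Integrable stdDensity := by
  simpa using integrable_stdDensity_mul_norm_pow 0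

theorem integral_stdDensity : ∫ z, stdDensity z = 1 := by
  have := integral_stdNoise (fun _ => (1 : ℝ))
  simpa using this.symm

end FadingChannel

end
noncomputable section

namespace FadingChannel

/-! ### Posterior mean and MMSE of a finite constellation -/

/-- `p` is a probability mass function on the finite constellation `S`. -/
structure IsPrior (S : Finset ℂ) (p : ℂ → ℝ) : Prop where
  nonneg : ∀ a, 0 ≤ p a
  sum_eq_one : ∑ a ∈ S, p a = 1

/-- The density of the output `c x + n`. -/
def outDensity (S : Finset ℂ) (p : ℂ → ℝ) (c y : ℂ) : ℝ :=
  ∑ b ∈ S, p b * stdDensity (y - c * b)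

/-- The posterior probability of the input `b` given the output `y = c x + n`. -/
def postWeight (S : Finset ℂ) (p : ℂ → ℝ) (c y b : ℂ) : ℝ :=
  p b * stdDensity (y - c * b) / outDensity S p c y

/-- The posterior mean of the input given the output `y = c x + n`. -/
def postMean (S : Finset ℂ) (p : ℂ → ℝ) (c y : ℂ) : ℂ :=
  ∑ b ∈ S, postWeight S p c y b • b

/-- The mean square error of the posterior mean in the channel `y = c x + n`. -/
def mmseFun (S : Finset ℂ) (p : ℂ → ℝ) (c : ℂ) : ℝ :=
  ∑ a ∈ S, p a * ∫ n, stdDensity n * ‖a - postMean S p c (c * a + n)‖ ^ 2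

/-- A bound for the modulus of the points of `S`. -/
def radius (S : Finset ℂ) : ℝ := ∑ a ∈ S, ‖a‖

theorem norm_le_radius {S : Finset ℂ} {a : ℂ} (ha : a ∈ S) : ‖a‖ ≤ radius S :=
  Finset.single_le_sum (f := fun a : ℂ => ‖a‖) (fun _ _ => norm_nonneg _) ha

theorem radius_nonneg (S : Finset ℂ) : 0 ≤ radius S := Finset.sum_nonneg fun _ _ => norm_nonneg _

theorem norm_sub_le_radius {S : Finset ℂ} {a b : ℂ} (ha : a ∈ S) (hb : b ∈ S) :
    ‖a - b‖ ≤ 2 * radius S := by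
  linarith [norm_sub_le a b, norm_le_radius ha, norm_le_radius hb]

variable {S : Finset ℂ} {p : ℂ → ℝ}

theorem IsPrior.exists_pos (hp : IsPrior S p) : ∃ a ∈ S, 0 < p a := by
  by_contra! h
  have : ∑ a ∈ S, p a ≤ 0 := Finset.sum_nonpos h
  linarith [hp.sum_eq_one]

theorem IsPrior.le_one (hp : IsPrior S p) {a : ℂ} (ha : a ∈ S) : p a ≤ 1 :=
  hp.sum_eq_one ▸ Finset.single_le_sum (fun b _ => hp.nonneg b) ha

theorem outDensity_pos (hp : IsPrior S p) (c y : ℂ) : 0 < outDensity S p c y := by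
  obtain ⟨a, ha, hpa⟩ := hp.exists_pos
  exact Finset.sum_pos' (fun b _ => mul_nonneg (hp.nonneg b) (stdDensity_pos _).le)
    ⟨a, ha, mul_pos hpa (stdDensity_pos _)⟩

theorem postWeight_nonneg (hp : IsPrior S p) (c y b : ℂ) : 0 ≤ postWeight S p c y b :=
  div_nonneg (mul_nonneg (hp.nonneg b) (stdDensity_pos _).le) (outDensity_pos hp c y).le

theorem sum_postWeight (hp : IsPrior S p) (c y : ℂ) : ∑ b ∈ S, postWeight S p c y b = 1 := by
  unfold postWeight
  rw [← Finset.sum_div]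
  exact div_self (outDensity_pos hp c y).ne'

theorem outDensity_mul_postWeight (hp : IsPrior S p) (c y b : ℂ) :
    outDensity S p c y * postWeight S p c y b = p b * stdDensity (y - c * b) :=
  mul_div_cancel₀ _ (outDensity_pos hp c y).ne'

@[fun_prop]
theorem continuous_outDensity {α : Type*} [TopologicalSpace α] {f g : α → ℂ} (hf : Continuous f)
    (hg : Continuous g) : Continuous fun t => outDensity S p (f t) (g t) := by
  unfold outDensity; fun_prop

theorem continuous_postWeight (hp : IsPrior S p) {α : Type*} [TopologicalSpace α] {f g : α → ℂ}
    (hf : Continuous f) (hg : Continuous g) (b : ℂ) :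
    Continuous fun t => postWeight S p (f t) (g t) b := by
  unfold postWeight
  exact Continuous.div (by fun_prop) (by fun_prop) fun t => (outDensity_pos hp _ _).ne'

theorem continuous_postMean (hp : IsPrior S p) {α : Type*} [TopologicalSpace α] {f g : α → ℂ}
    (hf : Continuous f) (hg : Continuous g) : Continuous fun t => postMean S p (f t) (g t) := by
  unfold postMean
  exact continuous_finsetSum _ fun b _ => (continuous_postWeight hp hf hg b).smul continuous_const

theorem sub_postMean (hp : IsPrior S p) (c y a : ℂ) :
    a - postMean S p c y = ∑ b ∈ S, postWeight S p c y b • (a - b) := by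
  simp only [smul_sub, Finset.sum_sub_distrib, ← Finset.sum_smul, sum_postWeight hp, one_smul]
  rfl

/-- The correct symbol contributes nothing to the error, so only the posterior weight of the wrong
symbols counts. -/
theorem norm_sub_postMean_le_sum (hp : IsPrior S p) (c y : ℂ) {a : ℂ} (ha : a ∈ S) :
    ‖a - postMean S p c y‖ ≤ 2 * radius S * ∑ b ∈ S.erase a, postWeight S p c y b := by
  rw [sub_postMean hp, ← Finset.add_sum_erase S _ ha, sub_self, smul_zero, zero_add,
    Finset.mul_sum]
  refine norm_sum_le_of_le _ fun b hb => ?_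
  rw [norm_smul, Real.norm_of_nonneg (postWeight_nonneg hp c y b), mul_comm]
  exact mul_le_mul_of_nonneg_right (norm_sub_le_radius ha (Finset.mem_of_mem_erase hb))
    (postWeight_nonneg hp c y b)

theorem sum_erase_postWeight_le_one (hp : IsPrior S p) (c y a : ℂ) :
    ∑ b ∈ S.erase a, postWeight S p c y b ≤ 1 :=
  (sum_postWeight hp c y).symm ▸ Finset.sum_le_sum_of_subset_of_nonneg (Finset.erase_subset _ _)
    fun b _ _ => postWeight_nonneg hp c y b

theorem norm_sub_postMean_sq_le_sum (hp : IsPrior S p) (c y : ℂ) {a : ℂ} (ha : a ∈ S) :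
    ‖a - postMean S p c y‖ ^ 2 ≤
      (2 * radius S) ^ 2 * ∑ b ∈ S.erase a, postWeight S p c y b := by
  have h0 : 0 ≤ ∑ b ∈ S.erase a, postWeight S p c y b :=
    Finset.sum_nonneg fun b _ => postWeight_nonneg hp c y b
  have h1 := sum_erase_postWeight_le_one hp c y a
  calc ‖a - postMean S p c y‖ ^ 2
      ≤ (2 * radius S * ∑ b ∈ S.erase a, postWeight S p c y b) ^ 2 := by
        gcongr; exact norm_sub_postMean_le_sum hp c y ha
    _ = (2 * radius S) ^ 2 * (∑ b ∈ S.erase a, postWeight S p c y b) ^ 2 := by ring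
    _ ≤ _ := by gcongr; nlinarith

theorem norm_sub_postMean_sq_le (hp : IsPrior S p) (c y : ℂ) {a : ℂ} (ha : a ∈ S) :
    ‖a - postMean S p c y‖ ^ 2 ≤ (2 * radius S) ^ 2 :=
  (norm_sub_postMean_sq_le_sum hp c y ha).trans
    (mul_le_of_le_one_right (sq_nonneg _) (sum_erase_postWeight_le_one hp c y a))

theorem norm_postMean_le (hp : IsPrior S p) (c y : ℂ) : ‖postMean S p c y‖ ≤ radius S := by
  calc ‖postMean S p c y‖ ≤ ∑ b ∈ S, postWeight S p c y b * radius S := by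
        refine norm_sum_le_of_le _ fun b hb => ?_
        rw [norm_smul, Real.norm_of_nonneg (postWeight_nonneg hp c y b)]
        exact mul_le_mul_of_nonneg_left (norm_le_radius hb) (postWeight_nonneg hp c y b)
    _ = radius S := by rw [← Finset.sum_mul, sum_postWeight hp, one_mul]

theorem continuous_sqError (hp : IsPrior S p) {α : Type*} [TopologicalSpace α]
    {f g : α → ℂ} (hf : Continuous f) (hg : Continuous g) (a : ℂ) :
    Continuous fun t => ‖a - postMean S p (f t) (g t)‖ ^ 2 :=
  ((continuous_const.sub (continuous_postMean hp hf hg)).norm).pow 2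

theorem integrable_stdDensity_mul_sqError (hp : IsPrior S p) (c : ℂ) {a : ℂ} (ha : a ∈ S) :
    Integrable fun n => stdDensity n * ‖a - postMean S p c (c * a + n)‖ ^ 2 := by
  refine (integrable_stdDensity.mul_const ((2 * radius S) ^ 2)).mono'
    (continuous_stdDensity.mul (continuous_sqError hp (by fun_prop) (by fun_prop) a)
      |>.aestronglyMeasurable) (.of_forall fun n => ?_)
  rw [Real.norm_of_nonneg (mul_nonneg (stdDensity_pos n).le (sq_nonneg _))]
  exact mul_le_mul_of_nonneg_left (norm_sub_postMean_sq_le hp _ _ ha) (stdDensity_pos n).le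

theorem mmseFun_nonneg (hp : IsPrior S p) (c : ℂ) : 0 ≤ mmseFun S p c :=
  Finset.sum_nonneg fun a _ => mul_nonneg (hp.nonneg a) <| integral_nonneg fun n =>
    mul_nonneg (stdDensity_pos n).le (sq_nonneg _)

theorem continuous_mmseFun (hp : IsPrior S p) : Continuous (mmseFun S p) := by
  refine continuous_finsetSum _ fun a ha => continuous_const.mul ?_
  refine continuous_of_dominated (bound := fun n => stdDensity n * (2 * radius S) ^ 2)
    (fun c => (integrable_stdDensity_mul_sqError hp c ha).aestronglyMeasurable)
    (fun c => .of_forall fun n => ?_) (integrable_stdDensity.mul_const _)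
    (.of_forall fun n => continuous_const.mul
      (continuous_sqError hp (by fun_prop) (by fun_prop) a))
  rw [Real.norm_of_nonneg (mul_nonneg (stdDensity_pos n).le (sq_nonneg _))]
  exact mul_le_mul_of_nonneg_left (norm_sub_postMean_sq_le hp _ _ ha) (stdDensity_pos n).le

theorem postMean_rotate {u : ℂ} (hu : ‖u‖ = 1) (c y : ℂ) :
    postMean S p (u * c) (u * y) = postMean S p c y := by
  have : ∀ b, stdDensity (u * y - u * c * b) = stdDensity (y - c * b) := fun b => by
    rw [← stdDensity_norm_mul hu (y - c * b)]; ring_nf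
  simp only [postMean, postWeight, outDensity, this]

/-- Circular symmetry of the noise: rotating gain and noise together only rotates the output. Hence
the MMSE is a radial function of the gain, which later supplies both evenness and polar coordinates.
-/
theorem mmseFun_rotate {u : ℂ} (hu : ‖u‖ = 1) (c : ℂ) :
    mmseFun S p (u * c) = mmseFun S p c := by
  refine Finset.sum_congr rfl fun a _ => ?_
  congr 1
  let v : Circle := ⟨u, by simpa [Submonoid.unitSphere] using hu⟩
  rw [← ((rotation v).measurePreserving).integral_comp
    (rotation v).toHomeomorph.measurableEmbedding]
  refine integral_congr_ae (.of_forall fun n => ?_)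
  have hv : (rotation v) n = u * n := rfl
  simp only [hv, stdDensity_norm_mul hu]
  rw [mul_assoc u c a, ← mul_add, postMean_rotate hu]

theorem mmseFun_ofReal_norm (c : ℂ) : mmseFun S p (‖c‖ : ℂ) = mmseFun S p c := by
  rcases eq_or_ne c 0 with rfl | hc
  · simp
  have hn : ((‖c‖ : ℝ) : ℂ) ≠ 0 := by simpa using hc
  rw [← mmseFun_rotate (u := c / ‖c‖) (by simp [hc]), div_mul_cancel₀ _ hn]

theorem mmseFun_neg (c : ℂ) : mmseFun S p (-c) = mmseFun S p c := by
  rw [← mmseFun_ofReal_norm, norm_neg, mmseFun_ofReal_norm]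

/-- Parallelogram identity `|n|² + |n+d|² = 2|n+d/2|² + |d|²/2`: the geometric mean of two Gaussian
densities is a Gaussian at the midpoint, damped by their distance. -/
theorem stdDensity_mul_stdDensity_add (n d : ℂ) :
    stdDensity n * stdDensity (n + d) =
      (stdDensity (n + d / 2) * Real.exp (-(‖d‖ ^ 2 / 4))) ^ 2 := by
  simp only [stdDensity, mul_pow, ← Real.exp_nat_mul]
  rw [mul_mul_mul_comm, ← Real.exp_add, mul_assoc (Real.pi⁻¹ ^ 2), ← Real.exp_add,
    sq Real.pi⁻¹]
  congr 2
  simp only [Complex.sq_norm, Complex.normSq_apply]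
  simp
  ring

/-- Bhattacharyya bound. With `A`, `B` the weighted densities of `a` and `b`, the left side is at
most `AB/(A+B) ≤ min(A, B) ≤ √(AB)`, and the priors are at most `1`. -/
theorem stdDensity_mul_postWeight_le (hp : IsPrior S p) (c n : ℂ) {a b : ℂ} (ha : a ∈ S)
    (hb : b ∈ S.erase a) :
    p a * (stdDensity n * postWeight S p c (c * a + n) b) ≤
      stdDensity (n + c * (a - b) / 2) * Real.exp (-(‖c * (a - b)‖ ^ 2 / 4)) := by
  set E := stdDensity (n + c * (a - b) / 2) * Real.exp (-(‖c * (a - b)‖ ^ 2 / 4)) with hE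
  have hE0 : 0 ≤ E := mul_nonneg (stdDensity_pos _).le (Real.exp_pos _).le
  have hba := Finset.ne_of_mem_erase hb
  have hbS := Finset.mem_of_mem_erase hb
  have hy : c * a + n - c * b = n + c * (a - b) := by ring
  have hq := outDensity_pos hp c (c * a + n)
  have hA : 0 ≤ p a * stdDensity n := mul_nonneg (hp.nonneg a) (stdDensity_pos _).le
  have hB : 0 ≤ p b * stdDensity (n + c * (a - b)) :=
    mul_nonneg (hp.nonneg b) (stdDensity_pos _).le
  have hsum : p a * stdDensity n + p b * stdDensity (n + c * (a - b)) ≤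
      outDensity S p c (c * a + n) := by
    have h : ∑ x ∈ {a, b}, p x * stdDensity (c * a + n - c * x) ≤
        outDensity S p c (c * a + n) :=
      Finset.sum_le_sum_of_subset_of_nonneg (by simp [Finset.insert_subset_iff, ha, hbS])
        fun x _ _ => mul_nonneg (hp.nonneg x) (stdDensity_pos _).le
    rwa [Finset.sum_pair hba.symm, hy, add_sub_cancel_left] at h
  have hAB : (p a * stdDensity n) * (p b * stdDensity (n + c * (a - b))) ≤ E ^ 2 := by
    rw [hE, ← stdDensity_mul_stdDensity_add, mul_mul_mul_comm]
    exact mul_le_of_le_one_left (mul_nonneg (stdDensity_pos _).le (stdDensity_pos _).le)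
      (mul_le_one₀ (hp.le_one ha) (hp.nonneg b) (hp.le_one hbS))
  rw [← mul_assoc, postWeight, hy, ← mul_div_assoc, div_le_iff₀ hq]
  refine le_trans ?_ (mul_le_mul_of_nonneg_left hsum hE0)
  generalize p a * stdDensity n = A at *
  generalize p b * stdDensity (n + c * (a - b)) = B at *
  -- Since `A B ≤ E²`, at least one of `A`, `B` is at most `E`.
  have : A * B ≤ E * (A + B) := by
    by_cases h1 : A ≤ E
    · nlinarith
    · have h2 : B ≤ E := by
        by_contra! h2
        nlinarith [not_le.1 h1]
      nlinarith
  exact this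

theorem exists_separation (S : Finset ℂ) :
    ∃ κ : ℝ, 0 < κ ∧ ∀ a ∈ S, ∀ b ∈ S.erase a, κ ≤ ‖a - b‖ ^ 2 / 4 := by
  rcases S.offDiag.eq_empty_or_nonempty with h | h
  · refine ⟨1, one_pos, fun a ha b hb => ?_⟩
    have : (a, b) ∈ S.offDiag := Finset.mem_offDiag.2
      ⟨ha, Finset.mem_of_mem_erase hb, (Finset.ne_of_mem_erase hb).symm⟩
    simp [h] at this
  · obtain ⟨x, hx, hmin⟩ := S.offDiag.exists_min_image (fun x => ‖x.1 - x.2‖ ^ 2 / 4) h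
    refine ⟨‖x.1 - x.2‖ ^ 2 / 4, ?_, fun a ha b hb => hmin (a, b) (Finset.mem_offDiag.2
      ⟨ha, Finset.mem_of_mem_erase hb, (Finset.ne_of_mem_erase hb).symm⟩)⟩
    have := norm_pos_iff.2 (sub_ne_zero.2 (Finset.mem_offDiag.1 hx).2.2)
    positivity

/-- Union bound over pairs of symbols: each translated Gaussian integrates to `1`, leaving
`exp(-|c|²|a-b|²/4)`, and a finite constellation has a positive minimal distance. -/
theorem mmseFun_le_exp (hp : IsPrior S p) :
    ∃ C κ : ℝ, 0 < κ ∧ ∀ c, mmseFun S p c ≤ C * Real.exp (-κ * ‖c‖ ^ 2) := by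
  obtain ⟨κ, hκ, hsep⟩ := exists_separation S
  refine ⟨∑ a ∈ S, ∑ b ∈ S.erase a, (2 * radius S) ^ 2, κ, hκ, fun c => ?_⟩
  rw [mmseFun, Finset.sum_mul]
  refine Finset.sum_le_sum fun a ha => ?_
  rw [← integral_const_mul, Finset.sum_mul]
  have hint : ∀ b, Integrable fun n => (2 * radius S) ^ 2 *
      (stdDensity (n + c * (a - b) / 2) * Real.exp (-(‖c * (a - b)‖ ^ 2 / 4))) := fun b =>
    ((integrable_stdDensity.comp_add_right _).mul_const _).const_mul _
  calc ∫ n, p a * (stdDensity n * ‖a - postMean S p c (c * a + n)‖ ^ 2)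
      ≤ ∫ n, ∑ b ∈ S.erase a, (2 * radius S) ^ 2 *
          (stdDensity (n + c * (a - b) / 2) * Real.exp (-(‖c * (a - b)‖ ^ 2 / 4))) := by
        refine integral_mono ((integrable_stdDensity_mul_sqError hp c ha).const_mul _)
          (integrable_finsetSum _ fun b _ => hint b) fun n => ?_
        calc p a * (stdDensity n * ‖a - postMean S p c (c * a + n)‖ ^ 2)
            ≤ p a * (stdDensity n * ((2 * radius S) ^ 2 *
                ∑ b ∈ S.erase a, postWeight S p c (c * a + n) b)) := by
              have := hp.nonneg a
              have := (stdDensity_pos n).le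
              gcongr
              exact norm_sub_postMean_sq_le_sum hp c _ ha
          _ = ∑ b ∈ S.erase a, (2 * radius S) ^ 2 *
                (p a * (stdDensity n * postWeight S p c (c * a + n) b)) := by
              simp only [Finset.mul_sum]
              exact Finset.sum_congr rfl fun b _ => by ring
          _ ≤ _ := Finset.sum_le_sum fun b hb => mul_le_mul_of_nonneg_left
              (stdDensity_mul_postWeight_le hp c n ha hb) (sq_nonneg _)
    _ = ∑ b ∈ S.erase a, (2 * radius S) ^ 2 * Real.exp (-(‖c * (a - b)‖ ^ 2 / 4)) := by
        rw [integral_finsetSum _ fun b _ => hint b]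
        refine Finset.sum_congr rfl fun b _ => ?_
        rw [integral_const_mul, integral_mul_const,
          integral_add_right_eq_self (fun n => stdDensity n), integral_stdDensity, one_mul]
    _ ≤ _ := by
        refine Finset.sum_le_sum fun b hb => mul_le_mul_of_nonneg_left
          (Real.exp_le_exp.2 ?_) (sq_nonneg _)
        rw [norm_mul, mul_pow]
        nlinarith [hsep a ha b hb, sq_nonneg ‖c‖]

/-- If the MMSE vanished, continuity would upgrade almost everywhere to everywhere, and every symbol
of positive probability would equal the posterior mean at the same output. -/
theorem mmseFun_pos (hp : IsPrior S p) {a b : ℂ} (ha : a ∈ S) (hb : b ∈ S) (hab : a ≠ b)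
    (hpa : 0 < p a) (hpb : 0 < p b) (c : ℂ) : 0 < mmseFun S p c := by
  have key : ∀ x ∈ S, 0 < p x → mmseFun S p c ≤ 0 → ∀ y, x = postMean S p c y := by
    intro x hx hpx h0 y
    have hterm : p x * ∫ n, stdDensity n * ‖x - postMean S p c (c * x + n)‖ ^ 2 ≤ 0 := by
      refine le_trans ?_ h0
      exact Finset.single_le_sum
        (f := fun a => p a * ∫ n, stdDensity n * ‖a - postMean S p c (c * a + n)‖ ^ 2)
        (fun a _ => mul_nonneg (hp.nonneg a) <| integral_nonneg fun n =>
          mul_nonneg (stdDensity_pos n).le (sq_nonneg _)) hx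
    have hcont : Continuous fun n => stdDensity n * ‖x - postMean S p c (c * x + n)‖ ^ 2 :=
      continuous_stdDensity.mul (continuous_sqError hp (by fun_prop) (by fun_prop) x)
    have hnn : 0 ≤ fun n => stdDensity n * ‖x - postMean S p c (c * x + n)‖ ^ 2 := fun n =>
      mul_nonneg (stdDensity_pos n).le (sq_nonneg _)
    have hz := (integral_eq_zero_iff_of_nonneg hnn (integrable_stdDensity_mul_sqError hp c hx)).1
      (le_antisymm (nonpos_of_mul_nonpos_right hterm hpx) (integral_nonneg hnn))
    have hz' : stdDensity (y - c * x) * ‖x - postMean S p c (c * x + (y - c * x))‖ ^ 2 = 0 :=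
      congrFun ((hcont.ae_eq_iff_eq volume continuous_zero).1 hz) (y - c * x)
    rw [add_sub_cancel, mul_eq_zero_iff_left (stdDensity_pos _).ne'] at hz'
    exact sub_eq_zero.1 (norm_eq_zero.1 ((pow_eq_zero_iff two_ne_zero).1 hz'))
  by_contra! h0
  exact hab ((key a ha hpa h0 0).trans (key b hb hpb h0 0).symm)

theorem mmseFun_eq_zero (hp : IsPrior S p) {a : ℂ} (h : ∀ b ∈ S, b ≠ a → p b = 0) (c : ℂ) :
    mmseFun S p c = 0 := by
  refine Finset.sum_eq_zero fun x hx => ?_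
  by_cases hxa : x = a
  · subst hxa
    refine mul_eq_zero_of_right _ (integral_eq_zero_of_ae (.of_forall fun n => ?_))
    have : x - postMean S p c (c * x + n) = 0 := by
      rw [sub_postMean hp]
      refine Finset.sum_eq_zero fun b hb => ?_
      by_cases hbx : b = x
      · simp [hbx]
      · simp [postWeight, h b hb hbx]
    simp [this]
  · rw [h x hx hxa, zero_mul]

end FadingChannel

end
noncomputable section

namespace FadingChannel

/-! ### The mutual information of a finite constellation and its derivative -/

variable {S : Finset ℂ} {p : ℂ → ℝ}

/-- The mutual information between the input and the output of the channel `y = c x + n`. -/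
def infoFun (S : Finset ℂ) (p : ℂ → ℝ) (c : ℂ) : ℝ :=
  ∑ a ∈ S, p a * ∫ n, stdDensity n *
    (Real.log (stdDensity n) - Real.log (outDensity S p c (c * a + n)))

/-- Bayes' rule: an average over input and noise becomes an average over the output `y = c a + n` of
a posterior average. -/
theorem sum_integral_stdDensity_smul {E : Type*} [NormedAddCommGroup E] [NormedSpace ℝ E]
    (hp : IsPrior S p) (c : ℂ) {G : ℂ → ℂ → E}
    (hG : ∀ a ∈ S, Integrable fun n => stdDensity n • G a (c * a + n)) :
    ∑ a ∈ S, p a • ∫ n, stdDensity n • G a (c * a + n) =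
      ∫ y, outDensity S p c y • ∑ a ∈ S, postWeight S p c y a • G a y := by
  have h : ∀ a ∈ S, Integrable fun y => p a • (stdDensity (y - c * a) • G a y) := fun a ha => by
    have := (hG a ha).comp_sub_right (c * a)
    simp only [add_sub_cancel] at this
    exact this.smul (p a)
  simp only [Finset.smul_sum, smul_smul, outDensity_mul_postWeight hp]
  simp only [mul_smul]
  rw [integral_finsetSum S h]
  refine Finset.sum_congr rfl fun a _ => ?_
  rw [integral_smul,
    ← integral_add_left_eq_self (fun y => stdDensity (y - c * a) • G a y) (c * a)]
  simp only [add_sub_cancel_left]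

theorem stdDensity_add_le (n d : ℂ) :
    stdDensity (n + d) ≤ stdDensity n * Real.exp (2 * ‖n‖ * ‖d‖ + ‖d‖ ^ 2) := by
  unfold stdDensity
  rw [mul_assoc, ← Real.exp_add]
  have h1 : ‖n‖ ≤ ‖n + d‖ + ‖d‖ := by simpa using norm_sub_le (n + d) d
  have h2 : ‖n‖ ^ 2 ≤ ‖n + d‖ ^ 2 + (2 * ‖n‖ * ‖d‖ + ‖d‖ ^ 2) := by
    by_cases h : ‖d‖ ≤ ‖n‖
    · nlinarith [norm_nonneg n, norm_nonneg d, norm_nonneg (n + d)]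
    · nlinarith [norm_nonneg n, norm_nonneg d, norm_nonneg (n + d)]
  gcongr
  linarith

theorem le_stdDensity_add (n d : ℂ) :
    stdDensity n * Real.exp (-(2 * ‖n‖ * ‖d‖ + ‖d‖ ^ 2)) ≤ stdDensity (n + d) := by
  unfold stdDensity
  rw [mul_assoc, ← Real.exp_add]
  have h1 := norm_add_le n d
  have h2 : ‖n + d‖ ^ 2 ≤ (‖n‖ + ‖d‖) ^ 2 := by gcongr
  gcongr
  nlinarith

/-- The output density is a convex combination of shifted Gaussians, each within a factor `exp(±K)`
of the unshifted one. The resulting growth, linear in `‖n‖`, is integrable. -/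
theorem abs_log_sub_log_outDensity_le (hp : IsPrior S p) (c n : ℂ) {a : ℂ} (ha : a ∈ S) :
    |Real.log (stdDensity n) - Real.log (outDensity S p c (c * a + n))| ≤
      2 * ‖n‖ * (‖c‖ * (2 * radius S)) + (‖c‖ * (2 * radius S)) ^ 2 := by
  set K := 2 * ‖n‖ * (‖c‖ * (2 * radius S)) + (‖c‖ * (2 * radius S)) ^ 2 with hK
  have hd : ∀ b ∈ S, 2 * ‖n‖ * ‖c * (a - b)‖ + ‖c * (a - b)‖ ^ 2 ≤ K := fun b hb => by
    have : ‖c * (a - b)‖ ≤ ‖c‖ * (2 * radius S) := by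
      rw [norm_mul]; gcongr; exact norm_sub_le_radius ha hb
    rw [hK]; gcongr
  have hy : ∀ b, c * a + n - c * b = n + c * (a - b) := fun b => by ring
  have hq : outDensity S p c (c * a + n) = ∑ b ∈ S, p b * stdDensity (n + c * (a - b)) := by
    simp only [outDensity, hy]
  have hφ := stdDensity_pos n
  have hup : outDensity S p c (c * a + n) ≤ stdDensity n * Real.exp K := by
    calc _ ≤ ∑ b ∈ S, p b * (stdDensity n * Real.exp K) := by
          rw [hq]
          refine Finset.sum_le_sum fun b hb => mul_le_mul_of_nonneg_left
            ((stdDensity_add_le n _).trans ?_) (hp.nonneg b)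
          gcongr; exact hd b hb
      _ = _ := by rw [← Finset.sum_mul, hp.sum_eq_one, one_mul]
  have hlo : stdDensity n * Real.exp (-K) ≤ outDensity S p c (c * a + n) := by
    calc _ = ∑ b ∈ S, p b * (stdDensity n * Real.exp (-K)) := by
          rw [← Finset.sum_mul, hp.sum_eq_one, one_mul]
      _ ≤ _ := by
          rw [hq]
          refine Finset.sum_le_sum fun b hb => mul_le_mul_of_nonneg_left
            (le_trans ?_ (le_stdDensity_add n _)) (hp.nonneg b)
          gcongr; exact hd b hb
  have h1 := Real.log_le_log (outDensity_pos hp _ _) hup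
  have h2 := Real.log_le_log (by positivity) hlo
  rw [Real.log_mul hφ.ne' (Real.exp_pos _).ne', Real.log_exp] at h1 h2
  rw [abs_le]
  constructor <;> linarith

theorem continuous_log_sub_log_outDensity (hp : IsPrior S p) (c a : ℂ) :
    Continuous fun n => Real.log (stdDensity n) - Real.log (outDensity S p c (c * a + n)) :=
  (continuous_stdDensity.log fun n => (stdDensity_pos n).ne').sub
    (Continuous.log (by fun_prop) fun n => (outDensity_pos hp _ _).ne')

theorem integrable_stdDensity_mul_affine (A B : ℝ) :
    Integrable fun n : ℂ => stdDensity n * (A * ‖n‖ + B) := by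
  have h1 := (integrable_stdDensity_mul_norm_pow 1).const_mul A
  have h0 := integrable_stdDensity.mul_const B
  exact (h1.add h0).congr (.of_forall fun n => by simp only [Pi.add_apply, pow_one]; ring)

theorem integrable_infoDensity (hp : IsPrior S p) (c : ℂ) {a : ℂ} (ha : a ∈ S) :
    Integrable fun n => stdDensity n *
      (Real.log (stdDensity n) - Real.log (outDensity S p c (c * a + n))) := by
  refine (integrable_stdDensity_mul_affine (2 * (‖c‖ * (2 * radius S)))
    ((‖c‖ * (2 * radius S)) ^ 2)).mono'
    (continuous_stdDensity.mul (continuous_log_sub_log_outDensity hp c a)).aestronglyMeasurable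
    (.of_forall fun n => ?_)
  rw [norm_mul, Real.norm_of_nonneg (stdDensity_pos n).le]
  refine mul_le_mul_of_nonneg_left ?_ (stdDensity_pos n).le
  refine (abs_log_sub_log_outDensity_le hp c n ha).trans (le_of_eq ?_)
  ring

theorem hasDerivAt_stdDensity_add (n d : ℂ) (γ : ℝ) :
    HasDerivAt (fun γ : ℝ => stdDensity (n + γ * d))
      (stdDensity (n + γ * d) * (-(2 * inner ℝ (n + γ * d) d))) γ := by
  have h1 : HasDerivAt (fun γ : ℝ => n + (γ : ℂ) * d) d γ := by
    simpa using ((Complex.ofRealCLM.hasDerivAt (x := γ)).mul_const d).const_add n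
  have h2 := (h1.norm_sq.neg.exp).const_mul Real.pi⁻¹
  refine HasDerivAt.congr_deriv (f := fun γ : ℝ => stdDensity (n + γ * d)) h2 ?_
  rw [← mul_assoc]
  rfl

/-- The derivative of the information density along the ray through the gain `h`. -/
def infoDeriv (S : Finset ℂ) (p : ℂ → ℝ) (c h a y : ℂ) : ℝ :=
  ∑ b ∈ S, postWeight S p c y b * (2 * inner ℝ (y - c * b) (h * (a - b)))

/-- Input and noise are held fixed while the output moves with `γ`, so the mixture components are
Gaussians at points affine in `γ`. -/
theorem hasDerivAt_log_outDensity (hp : IsPrior S p) (h a n : ℂ) (γ : ℝ) :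
    HasDerivAt (fun γ : ℝ => Real.log (outDensity S p (γ * h) (γ * h * a + n)))
      (-infoDeriv S p (γ * h) h a (γ * h * a + n)) γ := by
  have hy : ∀ (γ : ℝ) b, (γ : ℂ) * h * a + n - γ * h * b = n + γ * (h * (a - b)) := fun γ b => by
    ring
  have hq : ∀ γ : ℝ, outDensity S p (γ * h) (γ * h * a + n) =
      ∑ b ∈ S, p b * stdDensity (n + γ * (h * (a - b))) := fun γ => by
    simp only [outDensity, hy]
  have h1 := HasDerivAt.fun_sum (u := S) fun b (_ : b ∈ S) =>
    (hasDerivAt_stdDensity_add n (h * (a - b)) γ).const_mul (p b)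
  have h2 := h1.log (by rw [← hq]; exact (outDensity_pos hp _ _).ne')
  simp only [← hq] at h2
  convert h2 using 1
  simp only [infoDeriv, postWeight, hy, Finset.sum_div, ← Finset.sum_neg_distrib]
  exact Finset.sum_congr rfl fun b _ => by ring

theorem abs_infoDeriv_le (hp : IsPrior S p) (c h n : ℂ) {a : ℂ} (ha : a ∈ S) :
    |infoDeriv S p c h a (c * a + n)| ≤
      2 * ((‖n‖ + ‖c‖ * (2 * radius S)) * (‖h‖ * (2 * radius S))) := by
  have hR := radius_nonneg S
  calc |infoDeriv S p c h a (c * a + n)|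
      ≤ ∑ b ∈ S, postWeight S p c (c * a + n) b *
          (2 * ((‖n‖ + ‖c‖ * (2 * radius S)) * (‖h‖ * (2 * radius S)))) := by
        refine (Finset.abs_sum_le_sum_abs _ _).trans (Finset.sum_le_sum fun b hb => ?_)
        rw [abs_mul, abs_of_nonneg (postWeight_nonneg hp _ _ _), abs_mul, abs_two]
        have hab := norm_sub_le_radius ha hb
        have hy : c * a + n - c * b = n + c * (a - b) := by ring
        have h1 : ‖c * a + n - c * b‖ ≤ ‖n‖ + ‖c‖ * (2 * radius S) := by
          rw [hy]
          refine (norm_add_le _ _).trans ?_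
          rw [norm_mul]; gcongr
        have h2 : ‖h * (a - b)‖ ≤ ‖h‖ * (2 * radius S) := by rw [norm_mul]; gcongr
        have := postWeight_nonneg hp c (c * a + n) b
        gcongr
        exact (abs_real_inner_le_norm _ _).trans (by gcongr)
    _ = _ := by rw [← Finset.sum_mul, sum_postWeight hp, one_mul]

theorem continuous_infoDeriv (hp : IsPrior S p) (c h a : ℂ) :
    Continuous fun n => infoDeriv S p c h a (c * a + n) := by
  unfold infoDeriv
  exact continuous_finsetSum _ fun b _ =>
    (continuous_postWeight hp (by fun_prop) (by fun_prop) b).mul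
      (continuous_const.mul (Continuous.inner (by fun_prop) (by fun_prop)))

theorem integrable_stdDensity_mul_infoDeriv (hp : IsPrior S p) (c h : ℂ) {a : ℂ} (ha : a ∈ S) :
    Integrable fun n => stdDensity n * infoDeriv S p c h a (c * a + n) := by
  refine (integrable_stdDensity_mul_affine (2 * (‖h‖ * (2 * radius S)))
    (2 * (‖c‖ * (2 * radius S) * (‖h‖ * (2 * radius S))))).mono'
    (continuous_stdDensity.mul (continuous_infoDeriv hp c h a)).aestronglyMeasurable
    (.of_forall fun n => ?_)
  rw [norm_mul, Real.norm_of_nonneg (stdDensity_pos n).le]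
  refine mul_le_mul_of_nonneg_left ?_ (stdDensity_pos n).le
  refine (abs_infoDeriv_le hp c h n ha).trans (le_of_eq ?_)
  ring

/-- The algebra behind I-MMSE. With `m` the posterior mean, averaging over `a` turns `h(a-b)` into
`h(m-b)`. Splitting `y - cb = (y - cm) + γh(m-b)`, the first part averages to zero over `b` and the
second leaves the posterior variance. -/
theorem sum_postWeight_mul_infoDeriv (hp : IsPrior S p) (γ : ℝ) (h y : ℂ) :
    ∑ a ∈ S, postWeight S p (γ * h) y a * infoDeriv S p (γ * h) h a y =
      2 * γ * ‖h‖ ^ 2 *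
        ∑ a ∈ S, postWeight S p (γ * h) y a * ‖a - postMean S p (γ * h) y‖ ^ 2 := by
  set c : ℂ := γ * h with hc
  set m := postMean S p c y with hm
  set w := postWeight S p c y with hw
  have hmean : ∀ b, ∑ a ∈ S, w a • (a - b) = m - b := fun b => by
    have := sub_postMean hp c y b
    rw [← neg_sub, this, ← Finset.sum_neg_distrib]
    exact Finset.sum_congr rfl fun a _ => by rw [← smul_neg, neg_sub]
  have hlin : ∀ u : ℂ, ∀ g : ℂ → ℂ, ∑ a ∈ S, w a * inner ℝ u (h * g a) =
      inner ℝ u (h * ∑ a ∈ S, w a • g a) := fun u g => by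
    rw [Finset.mul_sum, inner_sum]
    exact Finset.sum_congr rfl fun a _ => by rw [mul_smul_comm, real_inner_smul_right]
  calc ∑ a ∈ S, w a * infoDeriv S p c h a y
      = ∑ b ∈ S, w b * (2 * ∑ a ∈ S, w a * inner ℝ (y - c * b) (h * (a - b))) := by
        simp only [infoDeriv, Finset.mul_sum]
        rw [Finset.sum_comm]
        exact Finset.sum_congr rfl fun b _ => Finset.sum_congr rfl fun a _ => by ring
    _ = ∑ b ∈ S, (2 * (w b * inner ℝ (y - c * m) (h * (m - b))) +
          2 * γ * ‖h‖ ^ 2 * (w b * ‖b - m‖ ^ 2)) := by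
        refine Finset.sum_congr rfl fun b _ => ?_
        have hsplit : y - c * b = (y - c * m) + γ • (h * (m - b)) := by
          rw [hc, Complex.real_smul]; ring
        rw [hlin, hmean, hsplit, inner_add_left, real_inner_smul_left,
          real_inner_self_eq_norm_sq, norm_mul, norm_sub_rev m b]
        ring
    _ = _ := by
        rw [Finset.sum_add_distrib, ← Finset.mul_sum, ← Finset.mul_sum, hlin]
        have : ∑ a ∈ S, w a • (m - a) = 0 := by rw [← sub_postMean hp c y m, ← hm, sub_self]
        rw [this]
        simp

/-- The I-MMSE relation, by differentiation under the integral. The amplitude `γ = √s` is used as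
parameter because everything is smooth in it, also at `0`. -/
theorem hasDerivAt_infoFun (hp : IsPrior S p) (h : ℂ) (γ : ℝ) :
    HasDerivAt (fun γ : ℝ => infoFun S p (γ * h))
      (2 * γ * ‖h‖ ^ 2 * mmseFun S p (γ * h)) γ := by
  have hR := radius_nonneg S
  have hterm : ∀ a ∈ S, HasDerivAt (fun γ : ℝ => ∫ n, stdDensity n *
      (Real.log (stdDensity n) - Real.log (outDensity S p (γ * h) (γ * h * a + n))))
      (∫ n, stdDensity n * infoDeriv S p (γ * h) h a (γ * h * a + n)) γ := by
    intro a ha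
    refine (hasDerivAt_integral_of_dominated_loc_of_deriv_le
      (bound := fun n => stdDensity n * (2 * (‖h‖ * (2 * radius S)) * ‖n‖ +
        2 * ((|γ| + 1) * ‖h‖ * (2 * radius S) * (‖h‖ * (2 * radius S)))))
      (Metric.ball_mem_nhds γ one_pos)
      (.of_forall fun x => (integrable_infoDensity hp _ ha).aestronglyMeasurable)
      (integrable_infoDensity hp _ ha)
      (integrable_stdDensity_mul_infoDeriv hp _ h ha).aestronglyMeasurable
      (F' := fun γ n => stdDensity n * infoDeriv S p (γ * h) h a (γ * h * a + n))
      (.of_forall fun n x hx => ?_) (integrable_stdDensity_mul_affine _ _)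
      (.of_forall fun n x _ => ?_)).2
    · rw [norm_mul, Real.norm_of_nonneg (stdDensity_pos n).le]
      refine mul_le_mul_of_nonneg_left ?_ (stdDensity_pos n).le
      refine (abs_infoDeriv_le hp _ h n ha).trans ?_
      have hx' : |x| ≤ |γ| + 1 := by
        have := abs_sub_abs_le_abs_sub x γ
        have h2 := Metric.mem_ball.1 hx
        rw [Real.dist_eq] at h2
        linarith
      have : ‖(x : ℂ) * h‖ ≤ (|γ| + 1) * ‖h‖ := by
        rw [norm_mul, Complex.norm_real, Real.norm_eq_abs]; gcongr
      calc 2 * ((‖n‖ + ‖(x : ℂ) * h‖ * (2 * radius S)) * (‖h‖ * (2 * radius S)))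
          ≤ 2 * ((‖n‖ + (|γ| + 1) * ‖h‖ * (2 * radius S)) * (‖h‖ * (2 * radius S))) := by
            gcongr
        _ = _ := by ring
    · have := ((hasDerivAt_log_outDensity hp h a n x).const_sub
        (Real.log (stdDensity n))).const_mul (stdDensity n)
      simpa using this
  have hsum := HasDerivAt.fun_sum (u := S) fun a ha => (hterm a ha).const_mul (p a)
  have hval : ∑ a ∈ S, p a * ∫ n, stdDensity n * infoDeriv S p (γ * h) h a (γ * h * a + n) =
      2 * γ * ‖h‖ ^ 2 * mmseFun S p (γ * h) := by
    -- Both sides are written as averages over the output, where the posterior identity compares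
    -- them pointwise.
    have h1 := sum_integral_stdDensity_smul hp (γ * h) (G := infoDeriv S p (γ * h) h)
      fun a ha => integrable_stdDensity_mul_infoDeriv hp (γ * h) h ha
    have h2 := sum_integral_stdDensity_smul hp (γ * h)
      (G := fun a y => ‖a - postMean S p (γ * h) y‖ ^ 2)
      fun a ha => integrable_stdDensity_mul_sqError hp (γ * h) ha
    simp only [smul_eq_mul] at h1 h2
    rw [h1, mmseFun, h2, ← integral_const_mul]
    refine integral_congr_ae (.of_forall fun y => ?_)
    simp only [sum_postWeight_mul_infoDeriv hp]
    ring
  rw [← hval]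
  exact hsum

theorem infoFun_zero (hp : IsPrior S p) : infoFun S p 0 = 0 := by
  refine Finset.sum_eq_zero fun a _ => ?_
  have : ∀ n, outDensity S p 0 n = stdDensity n := fun n => by
    simp [outDensity, ← Finset.sum_mul, hp.sum_eq_one]
  simp [this]

/-- The factor `2√t` cancels the derivative of `√t`. The square root is not differentiable at `0`,
so the derivative is used only inside the interval, with continuity at its ends. -/
theorem infoFun_sqrt_eq_integral (hp : IsPrior S p) (h : ℂ) {s : ℝ} (hs : 0 ≤ s) :
    infoFun S p (√s * h) = ∫ t in (0 : ℝ)..s, ‖h‖ ^ 2 * mmseFun S p (√t * h) := by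
  have hcont : Continuous fun γ : ℝ => infoFun S p (γ * h) :=
    continuous_iff_continuousAt.2 fun γ => (hasDerivAt_infoFun hp h γ).continuousAt
  have hderiv : ∀ t ∈ Set.Ioo 0 s, HasDerivAt (fun t : ℝ => infoFun S p (√t * h))
      (‖h‖ ^ 2 * mmseFun S p (√t * h)) t := by
    intro t ht
    have h1 := (hasDerivAt_infoFun hp h (√t)).comp t (Real.hasDerivAt_sqrt ht.1.ne')
    have : √t ≠ 0 := (Real.sqrt_pos.2 ht.1).ne'
    refine HasDerivAt.congr_deriv (f := fun t : ℝ => infoFun S p (√t * h)) h1 ?_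
    field_simp
  have hint : Continuous fun t : ℝ => ‖h‖ ^ 2 * mmseFun S p (√t * h) := by
    refine continuous_const.mul ((continuous_mmseFun hp).comp ?_)
    fun_prop
  rw [intervalIntegral.integral_eq_sub_of_hasDerivAt_of_le hs
    ((hcont.comp Real.continuous_sqrt).continuousOn) hderiv (hint.intervalIntegrable _ _)]
  simp [infoFun_zero hp]

end FadingChannel

end
noncomputable section

namespace FadingChannel

/-! ### The conditional MMSE and mutual information of a finitely supported input -/

section FiniteInput

variable {X : Measure ℂ} {S : Finset ℂ}

theorem eq_sum_smul_dirac (hX : X ((S : Set ℂ)ᶜ) = 0) :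
    X = ∑ a ∈ S, X {a} • Measure.dirac a := by
  ext s hs
  have h1 : X s = X (s ∩ S) := by
    have h0 : X (s \ S) = 0 := measure_mono_null (fun x hx => hx.2) hX
    rw [← measure_inter_add_sdiff s S.measurableSet, h0, add_zero]
  classical
  have h2 : s ∩ S = ((S.filter (· ∈ s) : Finset ℂ) : Set ℂ) := by
    ext x; simp [and_comm]
  rw [h1, h2, ← sum_measure_singleton, Finset.sum_filter]
  simp only [Measure.coe_finsetSum, Measure.smul_apply, Finset.sum_apply, smul_eq_mul,
    Measure.dirac_apply' _ hs, Set.indicator_apply, Pi.one_apply, mul_ite, mul_one, mul_zero]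

theorem isPrior_real [IsProbabilityMeasure X] (hX : X ((S : Set ℂ)ᶜ) = 0) :
    IsPrior S (fun a => X.real {a}) where
  nonneg _ := measureReal_nonneg
  sum_eq_one := by
    rw [sum_measureReal_singleton, measureReal_def, (prob_compl_eq_zero_iff S.measurableSet).1 hX]
    rfl

theorem lintegral_input (hX : X ((S : Set ℂ)ᶜ) = 0) (F : ℂ → ℝ≥0∞) :
    ∫⁻ x, F x ∂X = ∑ a ∈ S, X {a} * F a := by
  conv_lhs => rw [eq_sum_smul_dirac hX]
  rw [lintegral_finsetSum_measure]
  simp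

theorem inputNoise_eq_sum (hX : X ((S : Set ℂ)ᶜ) = 0) :
    inputNoise X = ∑ a ∈ S, X {a} • (complexGaussian 0 1).map (Prod.mk a) := by
  refine Measure.ext_of_lintegral _ fun F hF => ?_
  rw [inputNoise, lintegral_prod _ hF.aemeasurable, lintegral_input hX,
    lintegral_finsetSum_measure]
  refine Finset.sum_congr rfl fun a _ => ?_
  rw [lintegral_smul_measure, lintegral_map hF measurable_prodMk_left, smul_eq_mul]

variable {E : Type*} [NormedAddCommGroup E] [NormedSpace ℝ E]

theorem integrable_inputNoise [IsProbabilityMeasure X] (hX : X ((S : Set ℂ)ᶜ) = 0)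
    {F : ℂ × ℂ → E} (hF : ∀ a ∈ S, Integrable fun n => stdDensity n • F (a, n)) :
    Integrable F (inputNoise X) := by
  rw [inputNoise_eq_sum hX, integrable_finsetSum_measure]
  refine fun a ha => Integrable.smul_measure ?_ (measure_ne_top _ _)
  rw [(measurableEmbedding_prodMk_left a).integrable_map_iff]
  exact (integrable_stdNoise_iff _).2 (hF a ha)

theorem integral_inputNoise [IsProbabilityMeasure X] (hX : X ((S : Set ℂ)ᶜ) = 0)
    {F : ℂ × ℂ → E} (hF : ∀ a ∈ S, Integrable fun n => stdDensity n • F (a, n)) :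
    ∫ ω, F ω ∂(inputNoise X) = ∑ a ∈ S, X.real {a} • ∫ n, stdDensity n • F (a, n) := by
  have h : ∀ a ∈ S, Integrable F (X {a} • (complexGaussian 0 1).map (Prod.mk a)) := by
    refine fun a ha => Integrable.smul_measure ?_ (measure_ne_top _ _)
    rw [(measurableEmbedding_prodMk_left a).integrable_map_iff]
    exact (integrable_stdNoise_iff _).2 (hF a ha)
  rw [inputNoise_eq_sum hX, integral_finsetSum_measure h]
  refine Finset.sum_congr rfl fun a _ => ?_
  rw [integral_smul_measure, (measurableEmbedding_prodMk_left a).integral_map, integral_stdNoise]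
  rfl

theorem measurable_output (h : ℂ) (s : ℝ) : Measurable (output h s) := by
  unfold output; fun_prop

theorem measurable_fst_output (h : ℂ) (s : ℝ) :
    Measurable fun ω : ℂ × ℂ => (ω.1, output h s ω) :=
  measurable_fst.prodMk (measurable_output h s)

instance [IsProbabilityMeasure X] : IsProbabilityMeasure (inputNoise X) := by
  unfold inputNoise; infer_instance

instance [IsProbabilityMeasure X] (h : ℂ) (s : ℝ) : IsProbabilityMeasure (jointLaw X h s) :=
  Measure.isProbabilityMeasure_map (measurable_fst_output h s).aemeasurable

/-- Events of the conditioning σ-algebra have the form `y ∈ B`; on such an event Bayes' rule turns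
both set integrals into the same integral over `B`. -/
theorem condExp_input_eq_postMean [IsProbabilityMeasure X] (hX : X ((S : Set ℂ)ᶜ) = 0)
    (h : ℂ) (s : ℝ) :
    (fun ω => h * postMean S (fun a => X.real {a}) (√s * h) (output h s ω)) =ᵐ[inputNoise X]
      (inputNoise X)[fun ω : ℂ × ℂ => h * ω.1 |
        MeasurableSpace.comap (output h s) inferInstance] := by
  have hp := isPrior_real hX
  set p : ℂ → ℝ := fun a => X.real {a} with hpdef
  set c : ℂ := √s * h with hc
  have hmcont : Continuous (postMean S p c) := continuous_postMean hp (by fun_prop) (by fun_prop)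
  have hfst : Integrable (fun ω : ℂ × ℂ => h * ω.1) (inputNoise X) :=
    integrable_inputNoise hX fun a _ => integrable_stdDensity.smul_const (h * a)
  have hpost : ∀ a ∈ S, Integrable fun n => stdDensity n • (h * postMean S p c (c * a + n)) := by
    refine fun a _ => (integrable_stdDensity.mul_const (‖h‖ * radius S)).mono'
      (Continuous.aestronglyMeasurable (by fun_prop)) (.of_forall fun n => ?_)
    rw [norm_smul, Real.norm_of_nonneg (stdDensity_pos n).le, norm_mul]
    have := (stdDensity_pos n).le
    gcongr
    exact norm_postMean_le hp _ _
  have hpostI : Integrable (fun ω => h * postMean S p c (output h s ω)) (inputNoise X) :=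
    integrable_inputNoise hX hpost
  refine ae_eq_condExp_of_forall_setIntegral_eq (measurable_output h s).comap_le hfst
    (fun _ _ _ => hpostI.integrableOn) ?_ ?_
  · rintro _ ⟨B, hB, rfl⟩ -
    have hBm : MeasurableSet (output h s ⁻¹' B) := measurable_output h s hB
    rw [← integral_indicator hBm, ← integral_indicator hBm]
    have hind : ∀ a, Measurable fun n : ℂ => c * a + n := fun a => by fun_prop
    have h1 : ∀ a ∈ S, Integrable fun n =>
        stdDensity n • B.indicator (fun y => h * postMean S p c y) (c * a + n) := fun a ha => by
      refine ((hpost a ha).indicator (hind a hB)).congr (.of_forall fun n => ?_)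
      by_cases hn : c * a + n ∈ B <;> simp [Set.indicator, hn]
    have h2 : ∀ a ∈ S, Integrable fun n =>
        stdDensity n • B.indicator (fun _ => h * a) (c * a + n) := fun a _ => by
      refine ((integrable_stdDensity.smul_const (h * a)).indicator (hind a hB)).congr
        (.of_forall fun n => ?_)
      by_cases hn : c * a + n ∈ B <;> simp [Set.indicator, hn]
    have hL : (output h s ⁻¹' B).indicator (fun ω => h * postMean S p c (output h s ω)) =
        fun ω => B.indicator (fun y => h * postMean S p c y) (c * ω.1 + ω.2) := rfl
    have hR : (output h s ⁻¹' B).indicator (fun ω => h * ω.1) =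
        fun ω => B.indicator (fun _ => h * ω.1) (c * ω.1 + ω.2) := rfl
    rw [hL, hR]
    calc _ = ∑ a ∈ S, p a • ∫ n, stdDensity n •
          B.indicator (fun y => h * postMean S p c y) (c * a + n) :=
          integral_inputNoise hX
            (F := fun ω => B.indicator (fun y => h * postMean S p c y) (c * ω.1 + ω.2)) h1
      _ = ∑ a ∈ S, p a • ∫ n, stdDensity n • B.indicator (fun _ => h * a) (c * a + n) := by
          rw [sum_integral_stdDensity_smul hp c h1, sum_integral_stdDensity_smul hp c h2]
          refine integral_congr_ae (.of_forall fun y => ?_)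
          simp only
          congr 1
          by_cases hy : y ∈ B
          · simp only [Set.indicator_of_mem hy, ← Finset.sum_smul, sum_postWeight hp, one_smul]
            rw [postMean, Finset.mul_sum]
            exact Finset.sum_congr rfl fun b _ => mul_smul_comm _ _ _
          · simp [Set.indicator_of_notMem hy]
      _ = _ := (integral_inputNoise hX
            (F := fun ω => B.indicator (fun _ => h * ω.1) (c * ω.1 + ω.2)) h2).symm
  · exact ((measurable_const.mul hmcont.measurable).comp
      (comap_measurable (output h s))).aestronglyMeasurable

theorem condMmse_eq [IsProbabilityMeasure X] (hX : X ((S : Set ℂ)ᶜ) = 0) (h : ℂ) (s : ℝ) :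
    condMmse X h s = ‖h‖ ^ 2 * mmseFun S (fun a => X.real {a}) (√s * h) := by
  have hp := isPrior_real hX
  set p : ℂ → ℝ := fun a => X.real {a} with hpdef
  set c : ℂ := √s * h with hc
  have h1 : condMmse X h s =
      ∫ ω, ‖h‖ ^ 2 * ‖ω.1 - postMean S p c (c * ω.1 + ω.2)‖ ^ 2 ∂(inputNoise X) := by
    refine integral_congr_ae ((condExp_input_eq_postMean hX h s).mono fun ω hω => ?_)
    simp only
    rw [← hω, ← mul_sub, norm_mul, mul_pow]
    rfl
  have hint : ∀ a ∈ S, Integrable fun n =>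
      stdDensity n • ‖a - postMean S p c (c * a + n)‖ ^ 2 := fun a ha =>
    integrable_stdDensity_mul_sqError hp c ha
  rw [h1, integral_const_mul, integral_inputNoise hX hint]
  rfl

theorem lintegral_jointLaw (hX : X ((S : Set ℂ)ᶜ) = 0) (h : ℂ) (s : ℝ)
    {F : ℂ × ℂ → ℝ≥0∞} (hF : Measurable F) :
    ∫⁻ ω, F ω ∂(jointLaw X h s) = ∑ a ∈ S, X {a} *
      ∫⁻ y, ENNReal.ofReal (stdDensity (y - √s * h * a)) * F (a, y) := by
  have hm := measurable_fst_output h s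
  rw [jointLaw, lintegral_map hF hm, inputNoise_eq_sum hX, lintegral_finsetSum_measure]
  refine Finset.sum_congr rfl fun a _ => ?_
  have hG : Measurable fun ω : ℂ × ℂ => F (ω.1, output h s ω) := hF.comp hm
  have hGa : Measurable fun n => F (a, output h s (a, n)) := hG.comp measurable_prodMk_left
  rw [lintegral_smul_measure, lintegral_map hG measurable_prodMk_left, smul_eq_mul,
    stdNoise_eq_withDensity, lintegral_withDensity_eq_lintegral_mul _
      (continuous_stdDensity.measurable.ennreal_ofReal) hGa,
    ← lintegral_add_left_eq_self
      (fun y => ENNReal.ofReal (stdDensity (y - √s * h * a)) * F (a, y)) (√s * h * a)]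
  simp only [Pi.mul_apply, output, add_sub_cancel_left]

theorem fst_jointLaw [IsProbabilityMeasure X] (h : ℂ) (s : ℝ) : (jointLaw X h s).fst = X := by
  rw [jointLaw, Measure.fst_map_prodMk (measurable_output h s), inputNoise]
  exact Measure.fst_prod

theorem snd_jointLaw [IsProbabilityMeasure X] (hX : X ((S : Set ℂ)ᶜ) = 0) (h : ℂ) (s : ℝ) :
    (jointLaw X h s).snd = volume.withDensity
      fun y => ENNReal.ofReal (outDensity S (fun a => X.real {a}) (√s * h) y) := by
  have hp := isPrior_real hX
  refine Measure.ext_of_lintegral _ fun F hF => ?_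
  have hF2 : Measurable fun ω : ℂ × ℂ => F ω.2 := hF.comp measurable_snd
  rw [Measure.snd, lintegral_map hF measurable_snd, lintegral_jointLaw hX h s hF2,
    lintegral_withDensity_eq_lintegral_mul _ (Continuous.measurable (by fun_prop)).ennreal_ofReal
      hF]
  have hmeas : ∀ a, Measurable fun y => ENNReal.ofReal (stdDensity (y - √s * h * a)) * F y :=
    fun a => (Continuous.measurable (by fun_prop)).ennreal_ofReal.mul hF
  simp only [← lintegral_const_mul _ (hmeas _)]
  rw [← lintegral_finsetSum _ fun a _ => (hmeas a).const_mul _]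
  refine lintegral_congr fun y => ?_
  rw [Pi.mul_apply, outDensity, ENNReal.ofReal_sum_of_nonneg fun b _ =>
    mul_nonneg (hp.nonneg b) (stdDensity_pos _).le, Finset.sum_mul]
  refine Finset.sum_congr rfl fun a _ => ?_
  rw [ENNReal.ofReal_mul measureReal_nonneg, ofReal_measureReal, ← mul_assoc]

/-- Identifies the Radon–Nikodym derivative whose logarithm `klDiv` integrates. -/
theorem jointLaw_eq_withDensity [IsProbabilityMeasure X] (hX : X ((S : Set ℂ)ᶜ) = 0)
    (h : ℂ) (s : ℝ) :
    jointLaw X h s = ((jointLaw X h s).fst.prod (jointLaw X h s).snd).withDensity fun ω =>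
      ENNReal.ofReal (stdDensity (ω.2 - √s * h * ω.1) /
        outDensity S (fun a => X.real {a}) (√s * h) ω.2) := by
  have hp := isPrior_real hX
  set q := outDensity S (fun a => X.real {a}) (√s * h) with hq
  have hqm : Measurable q := Continuous.measurable (by rw [hq]; fun_prop)
  have hr : Measurable fun ω : ℂ × ℂ =>
      ENNReal.ofReal (stdDensity (ω.2 - √s * h * ω.1) / q ω.2) :=
    (Measurable.div (Continuous.measurable (by fun_prop)) (hqm.comp measurable_snd)).ennreal_ofReal
  refine Measure.ext_of_lintegral _ fun F hF => ?_
  rw [lintegral_withDensity_eq_lintegral_mul _ hr hF, lintegral_prod _ (hr.mul hF).aemeasurable,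
    fst_jointLaw, lintegral_input hX, lintegral_jointLaw hX h s hF]
  refine Finset.sum_congr rfl fun a _ => ?_
  have hFa : Measurable fun y =>
      ((fun ω : ℂ × ℂ => ENNReal.ofReal (stdDensity (ω.2 - √s * h * ω.1) / q ω.2)) * F) (a, y) :=
    (hr.mul hF).comp measurable_prodMk_left
  rw [snd_jointLaw hX, lintegral_withDensity_eq_lintegral_mul _ hqm.ennreal_ofReal hFa]
  congr 1
  refine lintegral_congr fun y => ?_
  have hqy : 0 < q y := outDensity_pos hp _ _
  simp only [Pi.mul_apply]
  rw [← mul_assoc, ← ENNReal.ofReal_mul hqy.le, mul_div_cancel₀ _ hqy.ne']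

theorem condMutualInfo_eq [IsProbabilityMeasure X] (hX : X ((S : Set ℂ)ᶜ) = 0)
    (h : ℂ) (s : ℝ) :
    condMutualInfo X h s =
      ENNReal.ofReal (infoFun S (fun a => X.real {a}) (√s * h)) := by
  have hp := isPrior_real hX
  set p : ℂ → ℝ := fun a => X.real {a} with hpdef
  set c : ℂ := √s * h with hc
  have hm := measurable_fst_output h s
  have hwd := jointLaw_eq_withDensity hX h s
  set ν := (jointLaw X h s).fst.prod (jointLaw X h s).snd with hν
  set r : ℂ × ℂ → ℝ := fun ω => stdDensity (ω.2 - c * ω.1) / outDensity S p c ω.2 with hr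
  have hqc : Continuous fun ω : ℂ × ℂ => outDensity S p c ω.2 := by fun_prop
  have hrm : Measurable r :=
    Measurable.div (Continuous.measurable (by fun_prop)) hqc.measurable
  have hrpos : ∀ ω, 0 < r ω := fun ω => div_pos (stdDensity_pos _) (outDensity_pos hp _ _)
  have hac : jointLaw X h s ≪ ν := by
    rw [hwd]; exact withDensity_absolutelyContinuous _ _
  have hllr : llr (jointLaw X h s) ν =ᵐ[jointLaw X h s] fun ω => Real.log (r ω) := by
    refine hac.ae_le ?_
    have := Measure.rnDeriv_withDensity ν hrm.ennreal_ofReal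
    rw [← hwd] at this
    filter_upwards [this] with ω hω
    rw [llr, hω, ENNReal.toReal_ofReal (hrpos ω).le]
  have hlog : ∀ a n, Real.log (r (a, output h s (a, n))) =
      Real.log (stdDensity n) - Real.log (outDensity S p c (c * a + n)) := fun a n => by
    have : output h s (a, n) = c * a + n := rfl
    simp only [hr, this, add_sub_cancel_left]
    exact Real.log_div (stdDensity_pos _).ne' (outDensity_pos hp _ _).ne'
  have hsm : AEStronglyMeasurable (fun ω => Real.log (r ω)) (jointLaw X h s) :=
    (Real.measurable_log.comp hrm).aestronglyMeasurable
  have hint : ∀ a ∈ S, Integrable fun n =>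
      stdDensity n • Real.log (r (a, output h s (a, n))) := fun a ha => by
    simp only [hlog]
    exact integrable_infoDensity hp c ha
  have hintJ : Integrable (fun ω => Real.log (r ω)) (jointLaw X h s) := by
    rw [jointLaw, integrable_map_measure hsm hm.aemeasurable]
    exact integrable_inputNoise hX hint
  rw [condMutualInfo, InformationTheory.klDiv_of_ac_of_integrable hac
    (hintJ.congr hllr.symm), integral_congr_ae hllr]
  -- `klDiv` carries a correction by the difference of total masses, which vanishes for two
  -- probability measures.
  simp only [probReal_univ, add_sub_cancel_right]
  congr 1
  rw [jointLaw, integral_map hm.aemeasurable hsm,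
    integral_inputNoise hX (F := fun ω => Real.log (r (ω.1, output h s ω))) hint]
  simp only [hlog]
  rfl

end FiniteInput

end FadingChannel

end
noncomputable section

namespace FadingChannel

/-! ### The Mellin transform of the canonical MMSE -/

section Mellin

variable {S : Finset ℂ} {p : ℂ → ℝ}

theorem exists_mmseFun_le_exp (hp : IsPrior S p) :
    ∃ C κ : ℝ, 0 ≤ C ∧ 0 < κ ∧ ∀ c, mmseFun S p c ≤ C * Real.exp (-κ * ‖c‖ ^ 2) := by
  obtain ⟨C, κ, hκ, h⟩ := mmseFun_le_exp hp
  exact ⟨|C|, κ, abs_nonneg C, hκ, fun c => (h c).trans (by gcongr; exact le_abs_self C)⟩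

theorem exists_mmseFun_le (hp : IsPrior S p) : ∃ C : ℝ, 0 ≤ C ∧ ∀ c, mmseFun S p c ≤ C := by
  obtain ⟨C, κ, hC, hκ, h⟩ := exists_mmseFun_le_exp hp
  refine ⟨C, hC, fun c => (h c).trans (mul_le_of_le_one_right hC (Real.exp_le_one_iff.2 ?_))⟩
  nlinarith [sq_nonneg ‖c‖]

theorem integrable_norm_pow_mul_mmseFun (hp : IsPrior S p) (k : ℕ) :
    Integrable fun u => ‖u‖ ^ k * mmseFun S p u := by
  obtain ⟨C, κ, -, hκ, h⟩ := exists_mmseFun_le_exp hp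
  refine ((integrable_norm_pow_mul_exp_neg_mul_sq k hκ).const_mul C).mono'
    ((continuous_norm.pow k).mul (continuous_mmseFun hp)).aestronglyMeasurable
    (.of_forall fun u => ?_)
  rw [Real.norm_of_nonneg (mul_nonneg (by positivity) (mmseFun_nonneg hp u))]
  calc _ ≤ ‖u‖ ^ k * (C * Real.exp (-κ * ‖u‖ ^ 2)) := by gcongr; exact h u
    _ = _ := by ring

theorem integrableOn_mul_mmseFun_sqrt (hp : IsPrior S p) :
    IntegrableOn (fun t : ℝ => t * mmseFun S p (√t : ℂ)) (Set.Ioi 0) := by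
  obtain ⟨C, κ, -, hκ, h⟩ := exists_mmseFun_le_exp hp
  have hexp := integrableOn_rpow_mul_exp_neg_mul_rpow (p := 1) (s := 1) (by norm_num) one_pos hκ
  simp only [Real.rpow_one] at hexp
  have hcont : Continuous fun t : ℝ => t * mmseFun S p (√t : ℂ) :=
    continuous_id.mul ((continuous_mmseFun hp).comp (by fun_prop))
  refine (hexp.const_mul C).mono' hcont.aestronglyMeasurable
    ((ae_restrict_iff' measurableSet_Ioi).2 (.of_forall fun t ht => ?_))
  have ht0 : (0 : ℝ) ≤ t := (Set.mem_Ioi.1 ht).le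
  rw [Real.norm_of_nonneg (mul_nonneg ht0 (mmseFun_nonneg hp _))]
  have h1 := h (√t : ℂ)
  rw [Complex.norm_real, Real.norm_of_nonneg (Real.sqrt_nonneg t), Real.sq_sqrt ht0] at h1
  calc _ ≤ t * (C * Real.exp (-κ * t)) := by gcongr
    _ = _ := by ring

/-- Polar coordinates give `2π ∫ r³ m(r) dr`, and `t = r²` turns this into the Mellin integral. -/
theorem integral_norm_sq_mul_mmseFun :
    ∫ u, ‖u‖ ^ 2 * mmseFun S p u =
      Real.pi * ∫ t in Set.Ioi (0 : ℝ), t * mmseFun S p (√t : ℂ) := by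
  have h1 := integral_fun_norm_addHaar (volume : Measure ℂ)
    (fun r : ℝ => r ^ 2 * mmseFun S p (r : ℂ))
  simp only [mmseFun_ofReal_norm] at h1
  have hball : (volume : Measure ℂ).real (Metric.ball 0 1) = Real.pi := by
    rw [measureReal_def, Complex.volume_ball]; simp
  have h2 := integral_comp_rpow_Ioi_of_pos (g := fun t : ℝ => t * mmseFun S p (√t : ℂ)) two_pos
  rw [h1, hball, ← h2, Complex.finrank_real_complex, ← integral_const_mul, nsmul_eq_mul,
    ← integral_smul, ← integral_const_mul]
  refine setIntegral_congr_fun measurableSet_Ioi fun r hr => ?_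
  have hr0 : (0 : ℝ) ≤ r := (Set.mem_Ioi.1 hr).le
  have h21 : (2 : ℝ) - 1 = 1 := by norm_num
  simp only [smul_eq_mul, h21, Real.rpow_one, Real.rpow_two, Real.sqrt_sq hr0]
  simp
  ring

variable {X : Measure ℂ} [IsProbabilityMeasure X]

theorem mmse_eq (hX : X ((S : Set ℂ)ᶜ) = 0) (t : ℝ) :
    mmse X t = mmseFun S (fun a => X.real {a}) (√t : ℂ) := by
  rw [mmse, condMmse_eq hX]; simp

theorem mellinConvergent_mmse (hX : X ((S : Set ℂ)ᶜ) = 0) :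
    MellinConvergent (fun t => (mmse X t : ℂ)) 2 := by
  refine IntegrableOn.congr_fun (integrableOn_mul_mmseFun_sqrt (isPrior_real hX)).ofReal
    (fun t ht => ?_) measurableSet_Ioi
  have h21 : (2 : ℂ) - 1 = 1 := by norm_num
  simp [mmse_eq hX, h21]

theorem mellinMmseTwo_eq (hX : X ((S : Set ℂ)ᶜ) = 0) :
    mellinMmseTwo X =
      ∫ t in Set.Ioi (0 : ℝ), t * mmseFun S (fun a => X.real {a}) (√t : ℂ) := by
  have h21 : (2 : ℂ) - 1 = 1 := by norm_num
  have : mellin (fun t => (mmse X t : ℂ)) 2 =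
      ∫ t in Set.Ioi (0 : ℝ), ((t * mmseFun S (fun a => X.real {a}) (√t : ℂ) : ℝ) : ℂ) := by
    refine setIntegral_congr_fun measurableSet_Ioi fun t _ => ?_
    simp [mmse_eq hX, h21]
  rw [mellinMmseTwo, this, integral_complex_ofReal, Complex.ofReal_re]

end Mellin

/-! ### The average MMSE and mutual information -/

theorem condMmse_nonneg (X : Measure ℂ) (h : ℂ) (s : ℝ) : 0 ≤ condMmse X h s :=
  integral_nonneg fun _ => sq_nonneg _

theorem avgMmse_nonneg (X H : Measure ℂ) (s : ℝ) : 0 ≤ avgMmse X H s :=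
  integral_nonneg fun h => condMmse_nonneg X h s

section Average

variable {S : Finset ℂ} {X : Measure ℂ} [IsProbabilityMeasure X] {H : Measure ℂ}

theorem avgMmse_eq (hX : X ((S : Set ℂ)ᶜ) = 0) (H : Measure ℂ) (s : ℝ) :
    avgMmse X H s = ∫ h, ‖h‖ ^ 2 * mmseFun S (fun a => X.real {a}) (√s * h) ∂H := by
  simp only [avgMmse, condMmse_eq hX]

theorem exists_condMmse_le (hX : X ((S : Set ℂ)ᶜ) = 0) :
    ∃ C : ℝ, 0 ≤ C ∧ ∀ h s, ‖condMmse X h s‖ ≤ C * ‖h‖ ^ 2 := by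
  obtain ⟨C, hC, h⟩ := exists_mmseFun_le (isPrior_real hX)
  refine ⟨C, hC, fun g s => ?_⟩
  rw [condMmse_eq hX, Real.norm_of_nonneg (mul_nonneg (sq_nonneg _)
    (mmseFun_nonneg (isPrior_real hX) _)), mul_comm]
  gcongr
  exact h _

theorem continuous_condMmse (hX : X ((S : Set ℂ)ᶜ) = 0) {α : Type*} [TopologicalSpace α]
    {f : α → ℂ} {g : α → ℝ} (hf : Continuous f) (hg : Continuous g) :
    Continuous fun t => condMmse X (f t) (g t) := by
  simp only [condMmse_eq hX]
  exact (hf.norm.pow 2).mul ((continuous_mmseFun (isPrior_real hX)).comp (by fun_prop))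

theorem aestronglyMeasurable_condMmse (hX : X ((S : Set ℂ)ᶜ) = 0) (s : ℝ) :
    AEStronglyMeasurable (fun h => condMmse X h s) H :=
  (continuous_condMmse hX continuous_id continuous_const).aestronglyMeasurable

theorem continuous_avgMmse (hX : X ((S : Set ℂ)ᶜ) = 0)
    (hH : Integrable (fun h : ℂ => ‖h‖ ^ 2) H) : Continuous (avgMmse X H) := by
  obtain ⟨C, hC, h⟩ := exists_condMmse_le hX
  exact continuous_of_dominated (fun s => aestronglyMeasurable_condMmse hX s)
    (fun s => .of_forall fun g => h g s) (hH.const_mul C)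
    (.of_forall fun g => continuous_condMmse hX continuous_const continuous_id)

theorem integrable_condMmse (hX : X ((S : Set ℂ)ᶜ) = 0)
    (hH : Integrable (fun h : ℂ => ‖h‖ ^ 2) H) (s : ℝ) :
    Integrable (fun h => condMmse X h s) H := by
  obtain ⟨C, hC, h⟩ := exists_condMmse_le hX
  exact (hH.const_mul C).mono' (aestronglyMeasurable_condMmse hX s) (.of_forall fun g => h g s)

/-- Tonelli applied to the I-MMSE integral: `avgMmse` becomes the marginal utility of power. -/
theorem avgMutualInfo_eq [SFinite H] (hX : X ((S : Set ℂ)ᶜ) = 0)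
    (hH : Integrable (fun h : ℂ => ‖h‖ ^ 2) H) {s : ℝ} (hs : 0 ≤ s) :
    avgMutualInfo X H s = ENNReal.ofReal (∫ t in (0 : ℝ)..s, avgMmse X H t) := by
  have hmeas := (continuous_condMmse hX (continuous_fst (X := ℂ) (Y := ℝ))
    continuous_snd).measurable.ennreal_ofReal
  have h1 : ∀ h, condMutualInfo X h s =
      ∫⁻ t in Set.Ioc 0 s, ENNReal.ofReal (condMmse X h t) := fun h => by
    have hc : Continuous fun t => condMmse X h t :=
      continuous_condMmse hX continuous_const continuous_id
    rw [condMutualInfo_eq hX, infoFun_sqrt_eq_integral (isPrior_real hX) h hs,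
      intervalIntegral.integral_of_le hs]
    simp only [← condMmse_eq hX]
    exact ofReal_integral_eq_lintegral_ofReal
      ((hc.integrableOn_Icc).mono_set Set.Ioc_subset_Icc_self) (.of_forall fun t => condMmse_nonneg X h t)
  rw [avgMutualInfo, intervalIntegral.integral_of_le hs, ofReal_integral_eq_lintegral_ofReal
    (((continuous_avgMmse hX hH).integrableOn_Icc).mono_set Set.Ioc_subset_Icc_self)
    (.of_forall fun t => avgMmse_nonneg X H t)]
  simp only [h1]
  rw [lintegral_lintegral_swap hmeas.aemeasurable]
  refine lintegral_congr fun t => ?_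
  rw [avgMmse, ofReal_integral_eq_lintegral_ofReal (integrable_condMmse hX hH t)
    (.of_forall fun h => condMmse_nonneg X h t)]

theorem avgMmse_dirac (a : ℂ) (H : Measure ℂ) (s : ℝ) : avgMmse (Measure.dirac a) H s = 0 := by
  have hX : Measure.dirac a ((({a} : Finset ℂ) : Set ℂ)ᶜ) = 0 := by simp
  rw [avgMmse_eq hX]
  simp [mmseFun_eq_zero (isPrior_real hX) (a := a) (by simp)]

theorem mellinMmseTwo_dirac (a : ℂ) : mellinMmseTwo (Measure.dirac a) = 0 := by
  have hX : Measure.dirac a ((({a} : Finset ℂ) : Set ℂ)ᶜ) = 0 := by simp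
  rw [mellinMmseTwo_eq hX]
  simp [mmseFun_eq_zero (isPrior_real hX) (a := a) (by simp)]

theorem exists_two_atoms (hX : X ((S : Set ℂ)ᶜ) = 0) (hne : ∀ a, X ≠ Measure.dirac a) :
    ∃ a ∈ S, ∃ b ∈ S, a ≠ b ∧ 0 < X.real {a} ∧ 0 < X.real {b} := by
  obtain ⟨a, ha, hpa⟩ := (isPrior_real hX).exists_pos
  by_contra! hcon
  have hz : ∀ b ∈ S, b ≠ a → X {b} = 0 := fun b hb hba => by
    have := le_antisymm (hcon a ha b hb hba.symm hpa) measureReal_nonneg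
    exact (measureReal_eq_zero_iff).1 this
  have hsum : X = X {a} • Measure.dirac a := by
    conv_lhs => rw [eq_sum_smul_dirac hX]
    exact Finset.sum_eq_single_of_mem a ha fun b hb hba => by rw [hz b hb hba, zero_smul]
  have h1 : X {a} = 1 := by
    have := congrArg (fun m : Measure ℂ => m Set.univ) hsum
    simpa using this.symm
  exact hne a (by rwa [h1, one_smul] at hsum)

theorem mmseFun_real_pos (hX : X ((S : Set ℂ)ᶜ) = 0) (hne : ∀ a, X ≠ Measure.dirac a) (c : ℂ) :
    0 < mmseFun S (fun a => X.real {a}) c := by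
  obtain ⟨a, ha, b, hb, hab, hpa, hpb⟩ := exists_two_atoms hX hne
  exact mmseFun_pos (isPrior_real hX) ha hb hab hpa hpb c

theorem mellinMmseTwo_pos (hX : X ((S : Set ℂ)ᶜ) = 0) (hne : ∀ a, X ≠ Measure.dirac a) :
    0 < mellinMmseTwo X := by
  rw [mellinMmseTwo_eq hX, setIntegral_pos_iff_support_of_nonneg_ae
    ((ae_restrict_iff' measurableSet_Ioi).2 (.of_forall fun t ht =>
      mul_nonneg (Set.mem_Ioi.1 ht).le (mmseFun_nonneg (isPrior_real hX) _)))
    (integrableOn_mul_mmseFun_sqrt (isPrior_real hX))]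
  refine lt_of_lt_of_le ?_ (measure_mono (s := Set.Ioi (0 : ℝ)) fun t ht =>
    ⟨(mul_pos (Set.mem_Ioi.1 ht) (mmseFun_real_pos hX hne _)).ne', ht⟩)
  simp

/-- The conditional MMSE can vanish only at gain `0`, which is a null set. -/
theorem avgMmse_pos [NeZero H] [NullSingletonClass H] (hX : X ((S : Set ℂ)ᶜ) = 0)
    (hH : Integrable (fun h : ℂ => ‖h‖ ^ 2) H) (hne : ∀ a, X ≠ Measure.dirac a) (s : ℝ) :
    0 < avgMmse X H s := by
  have hint := integrable_condMmse hX hH s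
  rw [avgMmse, integral_pos_iff_support_of_nonneg (fun h => condMmse_nonneg X h s) hint]
  have hsub : ({0}ᶜ : Set ℂ) ⊆ Function.support fun h => condMmse X h s := fun h hh => by
    rw [Function.mem_support, condMmse_eq hX]
    have : 0 < ‖h‖ := norm_pos_iff.2 hh
    exact (mul_pos (by positivity) (mmseFun_real_pos hX hne _)).ne'
  refine lt_of_lt_of_le ?_ (measure_mono hsub)
  rw [measure_compl (measurableSet_singleton 0) (by simp)]
  simp [NeZero.pos]

end Average

end FadingChannel

end
noncomputable section

namespace FadingChannel

/-! ### Asymptotics of the average MMSE under Rayleigh and Ricean fading -/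

theorem complexGaussian_absolutelyContinuous (μ : ℂ) {v : ℝ≥0} (hv : 0 < v) :
    complexGaussian μ v ≪ volume := by
  rw [complexGaussian_eq_withDensity μ hv]
  exact withDensity_absolutelyContinuous _ _

theorem nullSingletonClass_complexGaussian (μ : ℂ) {v : ℝ≥0} (hv : 0 < v) :
    NullSingletonClass (complexGaussian μ v) :=
  ⟨fun z => complexGaussian_absolutelyContinuous μ hv (measure_singleton z)⟩

theorem integrable_norm_sq_complexGaussian (μ : ℂ) {v : ℝ≥0} (hv : 0 < v) :
    Integrable (fun h : ℂ => ‖h‖ ^ 2) (complexGaussian μ v) := by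
  have hv' : (0 : ℝ) < v := hv
  rw [integrable_complexGaussian_iff μ hv]
  have hg : ∀ k : ℕ, Integrable fun z => ‖z - μ‖ ^ k * Real.exp (-(v : ℝ)⁻¹ * ‖z - μ‖ ^ 2) :=
    fun k => (integrable_norm_pow_mul_exp_neg_mul_sq k (inv_pos.2 hv')).comp_sub_right μ
  refine ((((hg 2).const_mul 2).add ((hg 0).const_mul (2 * ‖μ‖ ^ 2))).const_mul
    (Real.pi * v)⁻¹).mono' (Continuous.aestronglyMeasurable (by fun_prop))
    (.of_forall fun z => ?_)
  rw [norm_smul, Real.norm_of_nonneg (gaussDensity_pos hv' μ z).le,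
    Real.norm_of_nonneg (sq_nonneg _)]
  have h1 : ‖z‖ ≤ ‖z - μ‖ + ‖μ‖ := by simpa using norm_add_le (z - μ) μ
  have h2 : ‖z‖ ^ 2 ≤ 2 * ‖z - μ‖ ^ 2 + 2 * ‖μ‖ ^ 2 := by
    nlinarith [norm_nonneg z, sq_nonneg (‖z - μ‖ - ‖μ‖)]
  have h3 : gaussDensity μ v z = (Real.pi * v)⁻¹ * Real.exp (-(v : ℝ)⁻¹ * ‖z - μ‖ ^ 2) := by
    rw [gaussDensity]; congr 2; ring
  calc _ ≤ gaussDensity μ v z * (2 * ‖z - μ‖ ^ 2 + 2 * ‖μ‖ ^ 2) := by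
        have := (gaussDensity_pos hv' μ z).le
        gcongr
    _ = _ := by rw [h3]; simp only [Pi.add_apply, pow_zero]; ring

theorem gaussDensity_le {v : ℝ} (hv : 0 < v) (μ z : ℂ) : gaussDensity μ v z ≤ (Real.pi * v)⁻¹ :=
  mul_le_of_le_one_right (by positivity)
    (Real.exp_le_one_iff.2 (neg_nonpos.2 (by positivity)))

/-- In the even part of the density the mean enters only through `cosh`, so no linear term is left.
-/
theorem gaussDensity_add_neg (μ : ℂ) (v : ℝ) (z : ℂ) :
    (gaussDensity μ v z + gaussDensity μ v (-z)) / 2 =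
      gaussDensity μ v 0 * (Real.exp (-(‖z‖ ^ 2 / v)) * Real.cosh (2 * inner ℝ z μ / v)) := by
  have h1 : ‖z - μ‖ ^ 2 = ‖z‖ ^ 2 - 2 * inner ℝ z μ + ‖μ‖ ^ 2 := norm_sub_sq_real z μ
  have h2 : ‖-z - μ‖ ^ 2 = ‖z‖ ^ 2 + 2 * inner ℝ z μ + ‖μ‖ ^ 2 := by
    rw [norm_sub_sq_real, norm_neg, inner_neg_left]; ring
  have e1 : -(‖z - μ‖ ^ 2 / v) = -(‖μ‖ ^ 2 / v) + -(‖z‖ ^ 2 / v) + 2 * inner ℝ z μ / v := by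
    rw [h1]; ring
  have e2 : -(‖-z - μ‖ ^ 2 / v) = -(‖μ‖ ^ 2 / v) + -(‖z‖ ^ 2 / v) + -(2 * inner ℝ z μ / v) := by
    rw [h2]; ring
  simp only [gaussDensity, e1, e2, zero_sub, norm_neg, Real.exp_add, Real.cosh_eq]
  ring

/-- In the unit ball the elementary bounds on `exp` and `cosh` give a quadratic error; outside it
`‖z‖² ≥ 1` and the global bound `1/(πv)` on the density suffices. -/
theorem exists_abs_gaussDensity_second_difference_le (μ : ℂ) {v : ℝ} (hv : 0 < v) :
    ∃ K, 0 ≤ K ∧ ∀ z, |(gaussDensity μ v z + gaussDensity μ v (-z)) / 2 - gaussDensity μ v 0| ≤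
      K * ‖z‖ ^ 2 := by
  set c := gaussDensity μ v 0 with hc
  have hc0 : 0 < c := gaussDensity_pos hv μ 0
  set β := 2 * ‖μ‖ / v with hβ
  set B := (Real.pi * v)⁻¹ with hB
  have hB0 : 0 < B := by positivity
  refine ⟨c * (1 / v + β ^ 2 / 2 * Real.exp (β ^ 2 / 2)) + B, by positivity, fun z => ?_⟩
  by_cases hz : ‖z‖ ≤ 1
  · set a := ‖z‖ ^ 2 / v with ha
    set b := 2 * inner ℝ z μ / v with hb
    have ha0 : 0 ≤ a := by positivity
    have hbβ : |b| ≤ β * ‖z‖ := by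
      rw [hb, abs_div, abs_mul, abs_two, abs_of_pos hv, hβ, div_mul_eq_mul_div]
      refine div_le_div_of_nonneg_right ?_ hv.le
      linarith [abs_real_inner_le_norm z μ]
    have hb2 : b ^ 2 ≤ β ^ 2 * ‖z‖ ^ 2 := by
      rw [← sq_abs, ← mul_pow]; gcongr
    have hb2' : b ^ 2 ≤ β ^ 2 := hb2.trans
      (mul_le_of_le_one_right (sq_nonneg _) (pow_le_one₀ (norm_nonneg z) hz))
    have hlow : -a ≤ Real.exp (-a) * Real.cosh b - 1 := by
      have h1 := Real.add_one_le_exp (-a)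
      have h2 := Real.one_le_cosh b
      nlinarith [Real.exp_pos (-a)]
    -- From `cosh b ≤ eˣ` with `x = b²/2`, and `eˣ - 1 ≤ x eˣ`, which is `1 - x ≤ e⁻ˣ` multiplied by
    -- `eˣ`.
    have hupp : Real.exp (-a) * Real.cosh b - 1 ≤ b ^ 2 / 2 * Real.exp (b ^ 2 / 2) := by
      have h1 : Real.exp (-a) ≤ 1 := Real.exp_le_one_iff.2 (by linarith)
      have h2 := Real.cosh_le_exp_half_sq b
      have h3 := Real.add_one_le_exp (-(b ^ 2 / 2))
      have h4 : Real.exp (-(b ^ 2 / 2)) * Real.exp (b ^ 2 / 2) = 1 := by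
        rw [← Real.exp_add]; simp
      have h5 := Real.exp_pos (b ^ 2 / 2)
      have h6 := Real.cosh_pos b
      nlinarith
    have hupp' : Real.exp (-a) * Real.cosh b - 1 ≤
        β ^ 2 / 2 * Real.exp (β ^ 2 / 2) * ‖z‖ ^ 2 := by
      refine hupp.trans ?_
      calc b ^ 2 / 2 * Real.exp (b ^ 2 / 2)
          ≤ β ^ 2 * ‖z‖ ^ 2 / 2 * Real.exp (β ^ 2 / 2) := by gcongr
        _ = _ := by ring
    have habs : |Real.exp (-a) * Real.cosh b - 1| ≤
        (1 / v + β ^ 2 / 2 * Real.exp (β ^ 2 / 2)) * ‖z‖ ^ 2 := by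
      have h1 : 0 ≤ β ^ 2 / 2 * Real.exp (β ^ 2 / 2) * ‖z‖ ^ 2 := by positivity
      have h2 : a = 1 / v * ‖z‖ ^ 2 := by rw [ha]; ring
      rw [abs_le, add_mul]
      constructor <;> linarith
    rw [gaussDensity_add_neg, ← hc, ← mul_sub_one, abs_mul, abs_of_pos hc0]
    calc _ ≤ c * ((1 / v + β ^ 2 / 2 * Real.exp (β ^ 2 / 2)) * ‖z‖ ^ 2) := by gcongr
      _ ≤ _ := by nlinarith [sq_nonneg ‖z‖]
  · have hz1 : 1 ≤ ‖z‖ ^ 2 := one_le_pow₀ (not_le.1 hz).le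
    have h1 := gaussDensity_le hv μ z
    have h2 := gaussDensity_le hv μ (-z)
    have h3 := gaussDensity_le hv μ 0
    have h4 := gaussDensity_pos hv μ z
    have h5 := gaussDensity_pos hv μ (-z)
    have h6 : |(gaussDensity μ v z + gaussDensity μ v (-z)) / 2 - c| ≤ B := by
      rw [abs_le]; constructor <;> linarith
    have h7 : 0 ≤ c * (1 / v + β ^ 2 / 2 * Real.exp (β ^ 2 / 2)) := by positivity
    nlinarith

/-- Substitution `u = √s h`: one factor `s` is the Jacobian in real dimension two, the other comes
from `‖h‖²`. -/
theorem sq_mul_integral_gaussDensity_scale (μ : ℂ) (v : ℝ) (V : ℂ → ℝ) {s : ℝ} (hs : 0 < s) :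
    s ^ 2 * ∫ h, gaussDensity μ v h * (‖h‖ ^ 2 * V (√s * h)) =
      ∫ u, gaussDensity μ v ((√s)⁻¹ • u) * (‖u‖ ^ 2 * V u) := by
  have hs' : 0 < √s := Real.sqrt_pos.2 hs
  have h := Measure.integral_comp_smul (volume : Measure ℂ)
    (fun u => gaussDensity μ v ((√s)⁻¹ • u) * (‖u‖ ^ 2 * V u)) √s
  have hsq : √s ^ 2 = s := Real.sq_sqrt hs.le
  rw [Complex.finrank_real_complex, hsq, abs_of_pos (inv_pos.2 hs), smul_eq_mul,
    eq_inv_mul_iff_mul_eq₀ hs.ne'] at h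
  rw [← h, sq, mul_assoc, ← integral_const_mul]
  congr 1
  refine integral_congr_ae (.of_forall fun u => ?_)
  simp only [← Complex.real_smul, inv_smul_smul₀ hs'.ne', norm_smul,
    Real.norm_of_nonneg hs'.le, mul_pow, hsq]
  ring

/-- Evenness of `W` allows the density to be replaced by its even part. This improves the error from
`r` to `r²`, and with `r = 1/√s` it is the source of the rate `1/snr`, also for Ricean fading. -/
theorem exists_abs_integral_gaussDensity_scale_sub_le (μ : ℂ) {v : ℝ} (hv : 0 < v) {W : ℂ → ℝ}
    (hW0 : ∀ u, 0 ≤ W u) (hneg : ∀ u, W (-u) = W u) (hW : Integrable W)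
    (hW2 : Integrable fun u => ‖u‖ ^ 2 * W u) :
    ∃ K, 0 ≤ K ∧ ∀ r : ℝ, |(∫ u, gaussDensity μ v (r • u) * W u) - gaussDensity μ v 0 * ∫ u, W u| ≤
      K * r ^ 2 := by
  obtain ⟨K, hK, hdiff⟩ := exists_abs_gaussDensity_second_difference_le μ hv
  refine ⟨K * ∫ u, ‖u‖ ^ 2 * W u, mul_nonneg hK (integral_nonneg fun u =>
    mul_nonneg (sq_nonneg _) (hW0 u)), fun r => ?_⟩
  have hF : Integrable fun u => gaussDensity μ v (r • u) * W u := by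
    refine hW.bdd_mul (c := (Real.pi * v)⁻¹)
      ((continuous_gaussDensity μ v).comp (continuous_const_smul r)).aestronglyMeasurable
      (.of_forall fun u => ?_)
    rw [Real.norm_of_nonneg (gaussDensity_pos hv _ _).le]
    exact gaussDensity_le hv _ _
  have hF' : Integrable fun u => gaussDensity μ v (-(r • u)) * W u := by
    simpa only [hneg, smul_neg] using hF.comp_neg
  have hsymm : ∫ u, gaussDensity μ v (r • u) * W u =
      ∫ u, gaussDensity μ v (-(r • u)) * W u := by
    rw [← integral_neg_eq_self]
    simp only [hneg, smul_neg]
  have heq : (∫ u, gaussDensity μ v (r • u) * W u) - gaussDensity μ v 0 * ∫ u, W u =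
      ∫ u, ((gaussDensity μ v (r • u) + gaussDensity μ v (-(r • u))) / 2 - gaussDensity μ v 0) *
        W u := by
    have h1 : ∀ u, ((gaussDensity μ v (r • u) + gaussDensity μ v (-(r • u))) / 2 -
        gaussDensity μ v 0) * W u = 2⁻¹ * (gaussDensity μ v (r • u) * W u +
        gaussDensity μ v (-(r • u)) * W u) - gaussDensity μ v 0 * W u := fun u => by ring
    simp only [h1]
    rw [integral_sub (by exact (hF.add hF').const_mul _) (hW.const_mul _), integral_const_mul,
      integral_add hF hF', ← hsymm, integral_const_mul]
    ring
  rw [heq, ← Real.norm_eq_abs]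
  calc _ ≤ ∫ u, K * r ^ 2 * (‖u‖ ^ 2 * W u) := by
        refine norm_integral_le_of_norm_le (hW2.const_mul _) (.of_forall fun u => ?_)
        rw [norm_mul, Real.norm_of_nonneg (hW0 u), Real.norm_eq_abs]
        calc _ ≤ K * ‖r • u‖ ^ 2 * W u :=
              mul_le_mul_of_nonneg_right (hdiff (r • u)) (hW0 u)
          _ = _ := by rw [norm_smul, mul_pow, Real.norm_eq_abs, sq_abs]; ring
    _ = _ := by rw [integral_const_mul]; ring

/-- The constant `s² avgMmse(s)` tends to, for a gain of law `CN(μ, 2σ²)`. -/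
def fadingConst (X : Measure ℂ) (μ : ℂ) (σ : ℝ≥0) : ℝ :=
  Real.exp (-(‖μ‖ ^ 2 / (2 * (σ : ℝ) ^ 2))) * (mellinMmseTwo X / (2 * (σ : ℝ) ^ 2))

theorem exists_abs_sq_mul_avgMmse_sub_le {S : Finset ℂ} {X : Measure ℂ} [IsProbabilityMeasure X]
    (hX : X ((S : Set ℂ)ᶜ) = 0) (μ : ℂ) {σ : ℝ≥0} (hσ : 0 < σ) :
    ∃ K, 0 ≤ K ∧ ∀ s, 0 < s →
      |s ^ 2 * avgMmse X (complexGaussian μ (2 * σ ^ 2)) s - fadingConst X μ σ| ≤ K / s := by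
  have hv : 0 < 2 * σ ^ 2 := by positivity
  have hv' : (0 : ℝ) < ((2 * σ ^ 2 : ℝ≥0) : ℝ) := hv
  have hp := isPrior_real hX
  obtain ⟨K, hK, h⟩ := exists_abs_integral_gaussDensity_scale_sub_le μ hv'
    (W := fun u => ‖u‖ ^ 2 * mmseFun S (fun a => X.real {a}) u)
    (fun u => mul_nonneg (sq_nonneg _) (mmseFun_nonneg hp u))
    (fun u => by rw [norm_neg, mmseFun_neg]) (integrable_norm_pow_mul_mmseFun hp 2)
    ((integrable_norm_pow_mul_mmseFun hp 4).congr (.of_forall fun u => by ring))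
  refine ⟨K, hK, fun s hs => ?_⟩
  -- The `π` of the Gaussian normalization cancels the `π` of the polar coordinates.
  have hconst : fadingConst X μ σ = gaussDensity μ ((2 * σ ^ 2 : ℝ≥0) : ℝ) 0 *
      ∫ u, ‖u‖ ^ 2 * mmseFun S (fun a => X.real {a}) u := by
    have : (σ : ℝ) ≠ 0 := (show (0 : ℝ) < σ from hσ).ne'
    rw [integral_norm_sq_mul_mmseFun, ← mellinMmseTwo_eq hX, gaussDensity, fadingConst]
    push_cast
    rw [zero_sub, norm_neg]
    field_simp
  have h1 := h (√s)⁻¹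
  rw [inv_pow, Real.sq_sqrt hs.le, ← sq_mul_integral_gaussDensity_scale μ _ _ hs, ← hconst] at h1
  rw [avgMmse_eq hX, integral_complexGaussian μ hv]
  exact h1

end FadingChannel

end
noncomputable section

namespace FadingChannel

/-! ### Separable maximization under a total power constraint -/

section Separable

variable {k : ℕ} {P : ℝ} {F : Fin k → ℝ → ℝ} {p : Fin k → ℝ}

theorem sum_apply_update (F : Fin k → ℝ → ℝ) (p : Fin k → ℝ) (i : Fin k) (x : ℝ) :
    ∑ l, F l (Function.update p i x l) = ∑ l, F l (p l) - F i (p i) + F i x := by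
  rw [← Finset.add_sum_erase _ _ (Finset.mem_univ i),
    ← Finset.add_sum_erase _ (fun l => F l (p l)) (Finset.mem_univ i), Function.update_self]
  have : ∑ l ∈ Finset.univ.erase i, F l (Function.update p i x l) =
      ∑ l ∈ Finset.univ.erase i, F l (p l) :=
    Finset.sum_congr rfl fun l hl => by rw [Function.update_of_ne (Finset.ne_of_mem_erase hl)]
  rw [this]
  ring

theorem isCompact_feasibleSet (k : ℕ) (P : ℝ) : IsCompact (feasibleSet k P) := by
  refine (isCompact_Icc (a := (0 : Fin k → ℝ)) (b := fun _ => P)).of_isClosed_subset ?_ ?_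
  · have h1 : IsClosed {p : Fin k → ℝ | ∀ i, 0 ≤ p i} := by
      simp only [Set.ofPred_forall]
      exact isClosed_iInter fun i => isClosed_le continuous_const (continuous_apply i)
    exact h1.inter (isClosed_le (continuous_finsetSum _ fun i _ => continuous_apply i)
      continuous_const)
  · exact fun p hp => ⟨hp.1, fun i =>
      (Finset.single_le_sum (fun j _ => hp.1 j) (Finset.mem_univ i)).trans hp.2⟩

theorem zero_mem_feasibleSet (k : ℕ) {P : ℝ} (hP : 0 ≤ P) : (0 : Fin k → ℝ) ∈ feasibleSet k P :=
  ⟨fun _ => le_rfl, by simpa using hP⟩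

theorem le_of_mem_feasibleSet (hp : p ∈ feasibleSet k P) (i : Fin k) : p i ≤ P :=
  (Finset.single_le_sum (fun j _ => hp.1 j) (Finset.mem_univ i)).trans hp.2

theorem apply_add_le_of_isMaxOn (hp : p ∈ feasibleSet k P)
    (hmax : IsMaxOn (fun q => ∑ l, F l (q l)) (feasibleSet k P) p) (i : Fin k) {ε : ℝ}
    (hε : 0 ≤ ε) (hεP : ε ≤ P - ∑ l, p l) : F i (p i + ε) ≤ F i (p i) := by
  have hmem : Function.update p i (p i + ε) ∈ feasibleSet k P := by
    refine ⟨fun l => ?_, ?_⟩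
    · rcases eq_or_ne l i with rfl | hl
      · rw [Function.update_self]; exact add_nonneg (hp.1 l) hε
      · rw [Function.update_of_ne hl]; exact hp.1 l
    · rw [sum_apply_update (fun _ x => x)]; linarith
  have := hmax hmem
  simp only [Set.mem_ofPred_eq, sum_apply_update] at this
  linarith

/-- Moving power `ε` from `j` to `i` stays feasible. This exchange replaces a Lagrange multiplier
theorem below. -/
theorem apply_add_add_apply_sub_le_of_isMaxOn (hp : p ∈ feasibleSet k P)
    (hmax : IsMaxOn (fun q => ∑ l, F l (q l)) (feasibleSet k P) p) {i j : Fin k} (hij : i ≠ j)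
    {ε : ℝ} (hε : 0 ≤ ε) (hεj : ε ≤ p j) :
    F i (p i + ε) + F j (p j - ε) ≤ F i (p i) + F j (p j) := by
  set q := Function.update p i (p i + ε) with hq
  have hqj : q j = p j := Function.update_of_ne hij.symm _ _
  have hmem : Function.update q j (p j - ε) ∈ feasibleSet k P := by
    refine ⟨fun l => ?_, ?_⟩
    · rcases eq_or_ne l j with rfl | hl
      · rw [Function.update_self]; linarith
      · rw [Function.update_of_ne hl]
        rcases eq_or_ne l i with rfl | hl'
        · rw [hq, Function.update_self]; exact add_nonneg (hp.1 l) hε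
        · rw [hq, Function.update_of_ne hl']; exact hp.1 l
    · have := hp.2
      rw [sum_apply_update (fun _ x => x), hqj, hq, sum_apply_update (fun _ x => x)]; linarith
  have := hmax hmem
  simp only [Set.mem_ofPred_eq, sum_apply_update F q, hqj] at this
  rw [hq, sum_apply_update] at this
  linarith

theorem sum_eq_of_isMaxOn (hp : p ∈ feasibleSet k P)
    (hmax : IsMaxOn (fun q => ∑ l, F l (q l)) (feasibleSet k P) p) {i : Fin k}
    (hF : StrictMonoOn (F i) (Set.Ici 0)) : ∑ l, p l = P := by
  refine le_antisymm hp.2 (le_of_not_gt fun hlt => ?_)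
  have h1 := apply_add_le_of_isMaxOn hp hmax i (sub_nonneg.2 hlt.le) le_rfl
  exact absurd h1 (not_le.2 (hF (hp.1 i) (Set.mem_Ici.2 (by linarith [hp.1 i])) (by linarith)))

/-- A channel with constant utility could give all its power to `i` at no loss. -/
theorem apply_eq_zero_of_isMaxOn (hp : p ∈ feasibleSet k P)
    (hmax : IsMaxOn (fun q => ∑ l, F l (q l)) (feasibleSet k P) p) {i j : Fin k} (hij : i ≠ j)
    (hF : StrictMonoOn (F i) (Set.Ici 0)) (hj : ∀ x y, F j x = F j y) : p j = 0 := by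
  refine le_antisymm (le_of_not_gt fun hlt => ?_) (hp.1 j)
  have h1 := apply_add_add_apply_sub_le_of_isMaxOn hp hmax hij hlt.le le_rfl
  have h2 := hF (hp.1 i) (Set.mem_Ici.2 (by linarith [hp.1 i])) (show p i < p i + p j by linarith)
  rw [hj (p j - p j) (p j)] at h1
  linarith

/-- One-sided derivative of the exchange at `ε = 0`. Only `j` gives power away, so only `p j` has to
be positive. -/
theorem hasDerivAt_le_of_isMaxOn (hp : p ∈ feasibleSet k P)
    (hmax : IsMaxOn (fun q => ∑ l, F l (q l)) (feasibleSet k P) p) {i j : Fin k} (hj : 0 < p j)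
    {a b : ℝ} (hi' : HasDerivAt (F i) a (p i)) (hj' : HasDerivAt (F j) b (p j)) : a ≤ b := by
  rcases eq_or_ne i j with rfl | hij
  · exact (hi'.unique hj').le
  have h1 : HasDerivAt (fun ε : ℝ => F i (p i + ε)) a 0 := by
    have := HasDerivAt.comp_const_add (p i) 0 (by simpa using hi')
    simpa using this
  have h2 : HasDerivAt (fun ε : ℝ => F j (p j - ε)) (-b) 0 :=
    HasDerivAt.comp_const_sub (p j) 0 (by simpa using hj')
  have h3 := (hasDerivWithinAt_iff_tendsto_slope' (by simp)).1
    ((h1.add h2).hasDerivWithinAt (s := Set.Ioi 0))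
  have hle : a + -b ≤ 0 := by
    refine le_of_tendsto h3 ?_
    filter_upwards [Ioo_mem_nhdsGT hj] with ε hε
    have := apply_add_add_apply_sub_le_of_isMaxOn hp hmax hij hε.1.le hε.2.le
    rw [slope_def_field]
    refine div_nonpos_of_nonpos_of_nonneg ?_ (by linarith [hε.1])
    simp only [Pi.add_apply, add_zero, sub_zero]
    linarith
  linarith

end Separable

/-! ### Profiles of the average MMSE -/

/-- `g` is a marginal utility with `s² g(s) = A + O(1/s)`, either positive or identically zero. -/
structure IsMmseProfile (g : ℝ → ℝ) (A : ℝ) : Prop where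
  continuous : Continuous g
  asymp : ∃ K, 0 ≤ K ∧ ∀ s, 0 < s → |s ^ 2 * g s - A| ≤ K / s
  pos_or_zero : (0 < A ∧ ∀ s, 0 < g s) ∨ (A = 0 ∧ ∀ s, g s = 0)

section Profile

variable {g : ℝ → ℝ} {A : ℝ}

theorem IsMmseProfile.pos (hg : IsMmseProfile g A) (hA : 0 < A) (s : ℝ) : 0 < g s := by
  rcases hg.pos_or_zero with h | h
  · exact h.2 s
  · exact absurd h.1 hA.ne'

theorem IsMmseProfile.eq_zero (hg : IsMmseProfile g A) (hA : ¬ 0 < A) : A = 0 ∧ ∀ s, g s = 0 :=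
  hg.pos_or_zero.resolve_left fun h => hA h.1

theorem IsMmseProfile.nonneg (hg : IsMmseProfile g A) (s : ℝ) : 0 ≤ g s := by
  rcases hg.pos_or_zero with h | h
  · exact (h.2 s).le
  · exact (h.2 s).ge

theorem IsMmseProfile.hasDerivAt_integral_mul (hg : IsMmseProfile g A) (c x : ℝ) :
    HasDerivAt (fun x => ∫ t in (0 : ℝ)..c * x, g t) (c * g (c * x)) x := by
  have h1 := intervalIntegral.integral_hasDerivAt_right
    (hg.continuous.intervalIntegrable 0 (c * x))
    (hg.continuous.stronglyMeasurableAtFilter _ _) hg.continuous.continuousAt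
  have h2 : HasDerivAt (fun x => c * x) c x := by simpa using (hasDerivAt_id x).const_mul c
  exact (h1.comp x h2).congr_deriv (mul_comm _ _)

theorem IsMmseProfile.continuous_integral_mul (hg : IsMmseProfile g A) (c : ℝ) :
    Continuous fun x => ∫ t in (0 : ℝ)..c * x, g t :=
  continuous_iff_continuousAt.2 fun x => (hg.hasDerivAt_integral_mul c x).continuousAt

theorem IsMmseProfile.strictMono_integral_mul (hg : IsMmseProfile g A) (hA : 0 < A) {c : ℝ}
    (hc : 0 < c) : StrictMono fun x => ∫ t in (0 : ℝ)..c * x, g t :=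
  strictMono_of_deriv_pos fun x => by
    rw [(hg.hasDerivAt_integral_mul c x).deriv]
    exact mul_pos hc (hg.pos hA _)

theorem IsMmseProfile.exists_mul_sq_le (hg : IsMmseProfile g A) :
    ∃ C, 0 ≤ C ∧ ∀ s, 1 ≤ s → g s * s ^ 2 ≤ C := by
  obtain ⟨K, hK, h⟩ := hg.asymp
  refine ⟨|A| + K, by positivity, fun s hs => ?_⟩
  have h1 := (abs_le.1 (h s (by linarith))).2
  have h2 : K / s ≤ K := div_le_self hK hs
  linarith [le_abs_self A]

/-- Compactness on `[0, T]` and the expansion beyond `T`, where the error is at most `A/2`. The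
factor `(1 + s)²` in place of `s²` keeps the bound positive at `s = 0`. -/
theorem IsMmseProfile.exists_le_mul_sq (hg : IsMmseProfile g A) (hA : 0 < A) :
    ∃ c, 0 < c ∧ ∀ s, 0 ≤ s → c ≤ g s * (1 + s) ^ 2 := by
  obtain ⟨K, hK, h⟩ := hg.asymp
  set T := 2 * K / A + 1 with hT
  have hT0 : 0 < T := by positivity
  have hcont : Continuous fun s => g s * (1 + s) ^ 2 := hg.continuous.mul (by fun_prop)
  obtain ⟨x, hx, hmin⟩ := (isCompact_Icc (a := (0 : ℝ)) (b := T)).exists_isMinOn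
    ⟨0, le_rfl, hT0.le⟩ hcont.continuousOn
  have hx0 : 0 < g x * (1 + x) ^ 2 := by
    have := hg.pos hA x
    have := hx.1
    positivity
  refine ⟨min (g x * (1 + x) ^ 2) (A / 2), lt_min hx0 (half_pos hA), fun s hs => ?_⟩
  by_cases hsT : s ≤ T
  · exact (min_le_left _ _).trans (hmin ⟨hs, hsT⟩)
  · have hsT' := not_le.1 hsT
    have hs0 : 0 < s := hT0.trans hsT'
    have h1 := (abs_le.1 (h s hs0)).1
    have h2 : K / s ≤ A / 2 := by
      rw [div_le_iff₀ hs0]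
      have : K = A / 2 * (2 * K / A) := by field_simp
      nlinarith
    refine (min_le_right _ _).trans ?_
    have := (hg.pos hA s).le
    nlinarith

end Profile

/-! ### Optimal allocations at high SNR -/

section Allocation

variable {k : ℕ} {g : Fin k → ℝ → ℝ} {A : Fin k → ℝ} {P : ℝ}

/-- `p` maximizes the sum of the utilities with marginals `g i` under the power constraint. -/
def IsOptimal (g : Fin k → ℝ → ℝ) (P snr : ℝ) (p : Fin k → ℝ) : Prop :=
  p ∈ feasibleSet k P ∧
    IsMaxOn (fun q : Fin k → ℝ => ∑ i, ∫ t in (0 : ℝ)..snr * q i, g i t) (feasibleSet k P) p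

theorem exists_isOptimal (hg : ∀ i, IsMmseProfile (g i) (A i)) (hP : 0 ≤ P) (snr : ℝ) :
    ∃ p, IsOptimal g P snr p := by
  refine (isCompact_feasibleSet k P).exists_isMaxOn ⟨0, zero_mem_feasibleSet k hP⟩
    (Continuous.continuousOn ?_)
  exact continuous_finsetSum _ fun i _ =>
    ((hg i).continuous_integral_mul snr).comp (continuous_apply i)

variable {snr : ℝ} {p : Fin k → ℝ}

theorem IsOptimal.marginal_le (h : IsOptimal g P snr p) (hg : ∀ i, IsMmseProfile (g i) (A i))
    (hsnr : 0 < snr) (i : Fin k) {j : Fin k} (hj : 0 < p j) :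
    g i (snr * p i) ≤ g j (snr * p j) :=
  le_of_mul_le_mul_left (hasDerivAt_le_of_isMaxOn
    (F := fun i x => ∫ t in (0 : ℝ)..snr * x, g i t) h.1 h.2 hj
    ((hg i).hasDerivAt_integral_mul snr _) ((hg j).hasDerivAt_integral_mul snr _)) hsnr

theorem IsOptimal.sum_eq (h : IsOptimal g P snr p) (hg : ∀ i, IsMmseProfile (g i) (A i))
    (hsnr : 0 < snr) {i : Fin k} (hi : 0 < A i) : ∑ l, p l = P :=
  sum_eq_of_isMaxOn (F := fun i x => ∫ t in (0 : ℝ)..snr * x, g i t) h.1 h.2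
    (((hg i).strictMono_integral_mul hi hsnr).strictMonoOn _)

theorem IsOptimal.eq_zero (h : IsOptimal g P snr p) (hg : ∀ i, IsMmseProfile (g i) (A i))
    (hsnr : 0 < snr) {i j : Fin k} (hi : 0 < A i) (hj : ¬ 0 < A j) : p j = 0 :=
  apply_eq_zero_of_isMaxOn (F := fun i x => ∫ t in (0 : ℝ)..snr * x, g i t) h.1 h.2
    (fun hij => hj (hij ▸ hi)) (((hg i).strictMono_integral_mul hi hsnr).strictMonoOn _)
    fun x y => by simp [((hg j).eq_zero hj).2]

/-- By pigeonhole some channel `j` holds power at least `P/k`, so its marginal is `O(1/snr²)`.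
Optimality passes this bound to channel `i`, whose marginal is at least `c/(1+s)²`; hence `1 + snr
p_i` grows linearly in `snr`. -/
theorem exists_le_apply_of_isOptimal (hg : ∀ i, IsMmseProfile (g i) (A i)) (hP : 0 < P)
    {i : Fin k} (hi : 0 < A i) :
    ∃ δ, 0 < δ ∧ ∀ᶠ snr in atTop, ∀ p, IsOptimal g P snr p → δ ≤ p i := by
  choose C hC0 hC using fun j => (hg j).exists_mul_sq_le
  obtain ⟨c, hc, hlow⟩ := (hg i).exists_le_mul_sq hi
  have hk : 0 < (k : ℝ) := Nat.cast_pos.2 i.pos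
  -- The `+ 1` only makes `B` evidently positive.
  set B := (∑ j, C j) * (k / P) ^ 2 / c + 1 with hB
  have hCsum : 0 ≤ ∑ j, C j := Finset.sum_nonneg fun j _ => hC0 j
  have hB0 : 0 < B := by positivity
  -- The goal is `snr ≤ √B (1 + snr p_i)`; for `snr ≥ 2√B` the constant term absorbs at most half of
  -- `snr`, whence the factor `2`.
  refine ⟨1 / (2 * √B), by positivity, ?_⟩
  filter_upwards [eventually_ge_atTop (k / P), eventually_ge_atTop (2 * √B),
    eventually_gt_atTop 0] with snr h1 h2 hsnr p hp
  obtain ⟨j, -, hj⟩ : ∃ j ∈ Finset.univ, P / k ≤ p j := by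
    refine Finset.exists_le_of_sum_le ⟨i, Finset.mem_univ i⟩ ?_
    rw [hp.sum_eq hg hsnr hi]
    simp [mul_div_cancel₀ _ hk.ne']
  have hpj : 0 < p j := (div_pos hP hk).trans_le hj
  have hPk : (k / P) * (P / k) = 1 := by field_simp
  have hs1 : snr ≤ (k / P) * (snr * p j) := by
    calc snr = (k / P) * (snr * (P / k)) := by rw [mul_left_comm, hPk, mul_one]
      _ ≤ _ := by gcongr
  have hs2 : 1 ≤ snr * p j := by
    calc 1 = (k / P) * (P / k) := hPk.symm
      _ ≤ _ := by gcongr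
  have hle := hp.marginal_le hg hsnr i hpj
  have hpi := hp.1.1 i
  have hsi : 0 ≤ snr * p i := by positivity
  have key : c * snr ^ 2 ≤ (∑ j, C j) * (k / P) ^ 2 * (1 + snr * p i) ^ 2 := by
    have hgj := (hg j).nonneg (snr * p j)
    calc c * snr ^ 2 ≤ g i (snr * p i) * (1 + snr * p i) ^ 2 * snr ^ 2 := by
          gcongr; exact hlow _ hsi
      _ ≤ g j (snr * p j) * (1 + snr * p i) ^ 2 * ((k / P) * (snr * p j)) ^ 2 := by gcongr
      _ = g j (snr * p j) * (snr * p j) ^ 2 * ((k / P) ^ 2 * (1 + snr * p i) ^ 2) := by ring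
      _ ≤ (∑ j, C j) * ((k / P) ^ 2 * (1 + snr * p i) ^ 2) := by
          gcongr
          exact (hC j _ hs2).trans (Finset.single_le_sum (fun j _ => hC0 j) (Finset.mem_univ j))
      _ = _ := by ring
  have key2 : snr ^ 2 ≤ (√B * (1 + snr * p i)) ^ 2 := by
    rw [mul_pow, Real.sq_sqrt hB0.le]
    have : snr ^ 2 ≤ (∑ j, C j) * (k / P) ^ 2 / c * (1 + snr * p i) ^ 2 := by
      rw [div_mul_eq_mul_div, le_div_iff₀ hc]; linarith
    refine this.trans ?_
    gcongr
    linarith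
  have hsq := Real.sqrt_pos.2 hB0
  have key3 : snr ≤ √B * (1 + snr * p i) := le_of_sq_le_sq key2 (by positivity)
  rw [div_le_iff₀ (by positivity)]
  have : snr * 1 ≤ snr * (p i * (2 * √B)) := by linarith
  exact le_of_mul_le_mul_left this hsnr

end Allocation

end FadingChannel

end
noncomputable section

namespace FadingChannel

/-! ### Rate of convergence of the optimal allocations -/

section Asymptotics

variable {k : ℕ} {g : Fin k → ℝ → ℝ} {A : Fin k → ℝ} {P : ℝ} {p : ℝ → Fin k → ℝ}

/-- The multiplier is the marginal utility of `i₀`, a channel that eventually holds power;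
comparison of marginals in both directions gives equality for every other active channel. -/
theorem eventually_pos_multiplier (hg : ∀ i, IsMmseProfile (g i) (A i)) (hP : 0 < P) {i₀ : Fin k}
    (hi₀ : 0 < A i₀) (hp : ∀ᶠ snr in atTop, IsOptimal g P snr (p snr)) :
    ∀ᶠ snr in atTop, 0 < snr * g i₀ (snr * p snr i₀) ∧ ∀ i,
      snr * g i (snr * p snr i) ≤ snr * g i₀ (snr * p snr i₀) ∧
      (0 < p snr i → snr * g i (snr * p snr i) = snr * g i₀ (snr * p snr i₀)) := by
  obtain ⟨δ, hδ, hδp⟩ := exists_le_apply_of_isOptimal hg hP hi₀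
  filter_upwards [hp, hδp, eventually_gt_atTop 0] with snr hopt hge hsnr
  have hpos : 0 < p snr i₀ := hδ.trans_le (hge _ hopt)
  have hle := fun i => mul_le_mul_of_nonneg_left (hopt.marginal_le hg hsnr i hpos) hsnr.le
  refine ⟨mul_pos hsnr ((hg i₀).pos hi₀ _), fun i => ⟨hle i, fun hi => le_antisymm (hle i) ?_⟩⟩
  exact mul_le_mul_of_nonneg_left (hopt.marginal_le hg hsnr i₀ hi) hsnr.le

/-- With `L = λ snr`, `x = p_i` and `y = √(A_i/L)`, the expansion at `s = snr x` reads `|x² L - y²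
L| ≤ K/(δ snr)`. Dividing by `(x + y) L`, which is bounded below, gives the rate. -/
theorem isBigO_sub_sqrt_multiplier (hg : ∀ i, IsMmseProfile (g i) (A i)) (hP : 0 < P)
    {i₀ : Fin k} (hi₀ : 0 < A i₀) (hp : ∀ᶠ snr in atTop, IsOptimal g P snr (p snr)) (i : Fin k) :
    (fun snr => p snr i - √(A i * (1 / (snr * g i₀ (snr * p snr i₀) * snr)))) =O[atTop]
      fun snr : ℝ => 1 / snr := by
  by_cases hi : 0 < A i
  swap
  -- A constant input gets no power and has `A i = 0`, so the difference is exactly zero.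
  · refine IsBigO.of_norm_eventuallyLE ?_
    filter_upwards [hp, eventually_gt_atTop 0] with snr hopt hsnr
    rw [hopt.eq_zero hg hsnr hi₀ hi, ((hg i).eq_zero hi).1]
    simp [hsnr.le]
  obtain ⟨δ, hδ, hδp⟩ := exists_le_apply_of_isOptimal hg hP hi
  obtain ⟨K, hK, hasy⟩ := (hg i).asymp
  -- The quotient of `K/δ` by the lower bound `δ A_i/(2P²)` for `(x + y) L`.
  refine IsBigO.of_bound (2 * P ^ 2 * K / (A i * δ ^ 2)) ?_
  filter_upwards [hp, hδp, eventually_pos_multiplier hg hP hi₀ hp, eventually_gt_atTop 0,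
    eventually_ge_atTop (2 * K / (A i * δ))] with snr hopt hge hlam hsnr hbig
  have hδi := hge _ hopt
  have hpi : 0 < p snr i := hδ.trans_le hδi
  have hpP := le_of_mem_feasibleSet hopt.1 i
  obtain ⟨hlam0, hkkt⟩ := hlam
  have heq := (hkkt i).2 hpi
  set x := p snr i with hx
  set L := snr * g i₀ (snr * p snr i₀) * snr with hL
  have hL0 : 0 < L := mul_pos hlam0 hsnr
  have h1 : |x ^ 2 * L - A i| ≤ K / (δ * snr) := by
    have h2 := hasy (snr * x) (by positivity)
    have h3 : (snr * x) ^ 2 * g i (snr * x) = x ^ 2 * L := by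
      rw [hL, ← heq]; ring
    rw [h3] at h2
    refine h2.trans ?_
    rw [mul_comm δ]
    gcongr
  have hsmall : K / (δ * snr) ≤ A i / 2 := by
    rw [div_le_iff₀ (by positivity)]
    rw [div_le_iff₀ (by positivity)] at hbig
    linarith
  -- The error is at most `A_i/2`, so `x² L ≥ A_i/2`, while `x ≤ P`.
  have hLlow : A i / (2 * P ^ 2) ≤ L := by
    rw [div_le_iff₀ (by positivity)]
    have h2 := (abs_le.1 h1).1
    have h3 : x ^ 2 * L ≤ P ^ 2 * L := by gcongr
    linarith
  set y := √(A i * (1 / L)) with hy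
  have hy0 : 0 ≤ y := Real.sqrt_nonneg _
  have hyL : y ^ 2 * L = A i := by
    rw [hy, Real.sq_sqrt (by positivity)]; field_simp
  have h4 : |x - y| * ((x + y) * L) = |x ^ 2 * L - A i| := by
    rw [← hyL, ← abs_of_pos (show 0 < (x + y) * L by positivity), ← abs_mul]
    congr 1
    ring
  have h5 : δ * (A i / (2 * P ^ 2)) ≤ (x + y) * L := by
    have : δ ≤ x + y := by linarith
    gcongr
  rw [Real.norm_eq_abs, Real.norm_of_nonneg (by positivity : (0 : ℝ) ≤ 1 / snr)]
  have h6 : |x - y| * (δ * (A i / (2 * P ^ 2))) ≤ K / (δ * snr) :=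
    (mul_le_mul_of_nonneg_left h5 (abs_nonneg _)).trans (h4.le.trans h1)
  rw [← le_div_iff₀ (by positivity)] at h6
  refine h6.trans (le_of_eq ?_)
  field_simp

theorem sum_sqrt_pos {i₀ : Fin k} (hi₀ : 0 < A i₀) :
    0 < ∑ i, √(A i) :=
  Finset.sum_pos' (fun _ _ => Real.sqrt_nonneg _) ⟨i₀, Finset.mem_univ _, Real.sqrt_pos.2 hi₀⟩

/-- For `λ = B²/(P² snr)` the product `λ snr` is constant, so the normalized leading terms do not
depend on `snr`. -/
theorem sqrt_mul_one_div_sum_sqrt {B snr a : ℝ} (hB : 0 < B) (hP : 0 < P) (hsnr : 0 < snr)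
    (ha : 0 ≤ a) : √(a * (1 / (B ^ 2 / (P ^ 2 * snr) * snr))) = √a * (P / B) := by
  have : 1 / (B ^ 2 / (P ^ 2 * snr) * snr) = (P / B) ^ 2 := by field_simp
  rw [this, Real.sqrt_mul ha, Real.sqrt_sq (by positivity)]

/-- With `r = √(1/(λ snr))`, summing `p_i - √A_i r` over the channels gives `P - B r = O(1/snr)`;
subtracting `√A_i/B` times this eliminates `r`. -/
theorem isBigO_sub_sqrt_normalized (hg : ∀ i, IsMmseProfile (g i) (A i)) (hP : 0 < P)
    {i₀ : Fin k} (hi₀ : 0 < A i₀) (hp : ∀ᶠ snr in atTop, IsOptimal g P snr (p snr)) (i : Fin k) :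
    (fun snr => p snr i - √(A i) * (P / ∑ j, √(A j))) =O[atTop] fun snr : ℝ => 1 / snr := by
  have hA : ∀ j, 0 ≤ A j := fun j => (hg j).pos_or_zero.elim (fun h => h.1.le) fun h => h.1.ge
  set B := ∑ j, √(A j) with hB
  have hB0 : 0 < B := sum_sqrt_pos hi₀
  -- This is the multiplier already multiplied by `snr`.
  set lam := fun snr => snr * g i₀ (snr * p snr i₀) * snr with hlam
  have hO := isBigO_sub_sqrt_multiplier hg hP hi₀ hp
  have hsum := IsBigO.sum (s := Finset.univ) fun j (_ : j ∈ Finset.univ) => hO j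
  have hdiff := (hO i).sub (hsum.const_mul_left (√(A i) / B))
  refine hdiff.congr' ?_ EventuallyEq.rfl
  filter_upwards [hp, eventually_gt_atTop 0] with snr hopt hsnr
  have h1 : ∀ j, √(A j * (1 / lam snr)) = √(A j) * √(1 / lam snr) := fun j =>
    Real.sqrt_mul (hA j) _
  have h2 := hopt.sum_eq hg hsnr hi₀
  simp only [hlam] at h1
  simp only [Finset.sum_apply, h1, Finset.sum_sub_distrib, ← Finset.sum_mul, h2, ← hB]
  field_simp
  ring

end Asymptotics

/-! ### Transfer from abstract marginal utilities to the fading channels -/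

theorem isMmseProfile_avgMmse {S : Finset ℂ} {X : Measure ℂ} [IsProbabilityMeasure X]
    (hX : X ((S : Set ℂ)ᶜ) = 0) (μ : ℂ) {σ : ℝ≥0} (hσ : 0 < σ) :
    IsMmseProfile (avgMmse X (complexGaussian μ (2 * σ ^ 2))) (fadingConst X μ σ) := by
  have hv : 0 < 2 * σ ^ 2 := by positivity
  have hσ' : (0 : ℝ) < σ := hσ
  have hint := integrable_norm_sq_complexGaussian μ hv
  have := nullSingletonClass_complexGaussian μ hv
  refine ⟨continuous_avgMmse hX hint, exists_abs_sq_mul_avgMmse_sub_le hX μ hσ, ?_⟩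
  by_cases hne : ∀ a, X ≠ Measure.dirac a
  · refine Or.inl ⟨?_, avgMmse_pos hX hint hne⟩
    have := mellinMmseTwo_pos hX hne
    unfold fadingConst
    positivity
  · push Not at hne
    obtain ⟨a, rfl⟩ := hne
    refine Or.inr ⟨?_, avgMmse_dirac a _⟩
    simp [fadingConst, mellinMmseTwo_dirac]

theorem fadingConst_pos {S : Finset ℂ} {X : Measure ℂ} [IsProbabilityMeasure X]
    (hX : X ((S : Set ℂ)ᶜ) = 0) (hne : ∀ a, X ≠ Measure.dirac a) (μ : ℂ) {σ : ℝ≥0} (hσ : 0 < σ) :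
    0 < fadingConst X μ σ := by
  have := mellinMmseTwo_pos hX hne
  have hσ' : (0 : ℝ) < σ := hσ
  unfold fadingConst
  positivity

/-- On the feasible set the extended capacity is `ENNReal.ofReal` of a nonnegative real sum, so both
objectives order the allocations alike. -/
theorem isOptimalAllocation_iff {k : ℕ} {X H : Fin k → Measure ℂ} {P snr : ℝ} (hsnr : 0 ≤ snr)
    (hI : ∀ i s, 0 ≤ s → avgMutualInfo (X i) (H i) s =
      ENNReal.ofReal (∫ t in (0 : ℝ)..s, avgMmse (X i) (H i) t)) (p : Fin k → ℝ) :
    IsOptimalAllocation X H P snr p ↔ IsOptimal (fun i => avgMmse (X i) (H i)) P snr p := by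
  have hnn : ∀ q ∈ feasibleSet k P, ∀ i,
      0 ≤ ∫ t in (0 : ℝ)..snr * q i, avgMmse (X i) (H i) t := fun q hq i =>
    intervalIntegral.integral_nonneg (mul_nonneg hsnr (hq.1 i)) fun t _ => avgMmse_nonneg _ _ t
  have hcap : ∀ q ∈ feasibleSet k P, capacity X H snr q =
      ENNReal.ofReal (∑ i, ∫ t in (0 : ℝ)..snr * q i, avgMmse (X i) (H i) t) := fun q hq => by
    rw [ENNReal.ofReal_sum_of_nonneg fun i _ => hnn q hq i]
    exact Finset.sum_congr rfl fun i _ => hI i _ (mul_nonneg hsnr (hq.1 i))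
  refine and_congr_right fun hp => forall₂_congr fun q hq => ?_
  simp only [Set.mem_ofPred_eq]
  rw [hcap q hq, hcap p hp, ENNReal.ofReal_le_ofReal_iff (Finset.sum_nonneg fun i _ => hnn p hp i)]

end FadingChannel

end

theorem mainTheorem11 (k : ℕ) (X : Fin k → Measure ℂ) [∀ i, IsProbabilityMeasure (X i)]
    (hX : ∀ i, ∃ S : Finset ℂ, X i ((S : Set ℂ)ᶜ) = 0)
    (hne : ∃ i, ∀ a : ℂ, X i ≠ Measure.dirac a)
    (μ : Fin k → ℂ) (σ : Fin k → ℝ≥0) (hσ : ∀ i, 0 < σ i)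
    (H : Fin k → Measure ℂ) (hH : ∀ i, H i = FadingChannel.complexGaussian (μ i) (2 * σ i ^ 2))
    (P : ℝ) (hP : 0 < P) :
    (∀ i, MellinConvergent (fun t => (FadingChannel.mmse (X i) t : ℂ)) 2) ∧
    (∀ snr : ℝ, 0 < snr → ∃ p, FadingChannel.IsOptimalAllocation X H P snr p) ∧
    ∀ p : ℝ → Fin k → ℝ,
      (∀ᶠ snr in atTop, FadingChannel.IsOptimalAllocation X H P snr (p snr)) →
      (∀ᶠ snr in atTop, ∑ i, p snr i = P) ∧
      (∃ lam : ℝ → ℝ,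
        (∀ snr : ℝ, 0 < snr → 0 < lam snr ∧
          ∑ i, FadingChannel.leadingPower (X i) (μ i) (σ i) (lam snr) snr = P) ∧
        ∀ i, (fun snr => p snr i - FadingChannel.leadingPower (X i) (μ i) (σ i) (lam snr) snr)
          =O[atTop] (fun snr : ℝ => 1 / snr)) ∧
      (∃ lam : ℝ → ℝ,
        (∀ᶠ snr in atTop, 0 < lam snr ∧
          FadingChannel.IsPowerMultiplier X H snr (p snr) (lam snr)) ∧
        ∀ i, (fun snr => p snr i - FadingChannel.leadingPower (X i) (μ i) (σ i) (lam snr) snr)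
          =O[atTop] (fun snr : ℝ => 1 / snr)) := by
  choose S hS using hX
  obtain ⟨i₀, hi₀⟩ := hne
  have hg : ∀ i, FadingChannel.IsMmseProfile (FadingChannel.avgMmse (X i) (H i))
      (FadingChannel.fadingConst (X i) (μ i) (σ i)) := fun i =>
    hH i ▸ FadingChannel.isMmseProfile_avgMmse (hS i) (μ i) (hσ i)
  have hA₀ := FadingChannel.fadingConst_pos (hS i₀) hi₀ (μ i₀) (hσ i₀)
  have hI : ∀ i s, 0 ≤ s → FadingChannel.avgMutualInfo (X i) (H i) s =
      ENNReal.ofReal (∫ t in (0 : ℝ)..s, FadingChannel.avgMmse (X i) (H i) t) := fun i s hs => by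
    have hv : 0 < 2 * σ i ^ 2 := by have := hσ i; positivity
    rw [hH i]
    exact FadingChannel.avgMutualInfo_eq (hS i)
      (FadingChannel.integrable_norm_sq_complexGaussian (μ i) hv) hs
  have hB := FadingChannel.sum_sqrt_pos
    (A := fun i => FadingChannel.fadingConst (X i) (μ i) (σ i)) hA₀
  set B := ∑ i, √(FadingChannel.fadingConst (X i) (μ i) (σ i)) with hBdef
  have hnn : ∀ i, 0 ≤ FadingChannel.fadingConst (X i) (μ i) (σ i) := fun i =>
    (hg i).pos_or_zero.elim (fun h => h.1.le) fun h => h.1.ge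
  have hlead : ∀ i (snr : ℝ), 0 < snr →
      FadingChannel.leadingPower (X i) (μ i) (σ i) (B ^ 2 / (P ^ 2 * snr)) snr =
        √(FadingChannel.fadingConst (X i) (μ i) (σ i)) * (P / B) := fun i snr hsnr =>
    FadingChannel.sqrt_mul_one_div_sum_sqrt hB hP hsnr (hnn i)
  refine ⟨fun i => FadingChannel.mellinConvergent_mmse (hS i), fun snr hsnr => ?_, fun p hp => ?_⟩
  · obtain ⟨p, hp⟩ := FadingChannel.exists_isOptimal hg hP.le snr
    exact ⟨p, (FadingChannel.isOptimalAllocation_iff hsnr.le hI p).2 hp⟩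
  · have hopt : ∀ᶠ snr in atTop, FadingChannel.IsOptimal
        (fun i => FadingChannel.avgMmse (X i) (H i)) P snr (p snr) := by
      filter_upwards [hp, eventually_ge_atTop 0] with snr h hsnr
      exact (FadingChannel.isOptimalAllocation_iff hsnr hI _).1 h
    -- The first `λ` is forced by the leading terms summing to `P`; the second is the marginal
    -- utility of the nonconstant input `i₀`.
    refine ⟨?_, ⟨fun snr => B ^ 2 / (P ^ 2 * snr), fun snr hsnr => ⟨by positivity, ?_⟩, fun i => ?_⟩,
      ⟨fun snr => snr * FadingChannel.avgMmse (X i₀) (H i₀) (snr * p snr i₀),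
        FadingChannel.eventually_pos_multiplier hg hP hA₀ hopt,
        FadingChannel.isBigO_sub_sqrt_multiplier hg hP hA₀ hopt⟩⟩
    · filter_upwards [hopt, eventually_gt_atTop 0] with snr h hsnr
      exact h.sum_eq hg hsnr hA₀
    · simp only [hlead _ snr hsnr]
      rw [← Finset.sum_mul, ← hBdef, mul_div_cancel₀ _ hB.ne']
    · refine (FadingChannel.isBigO_sub_sqrt_normalized hg hP hA₀ hopt i).congr' ?_ EventuallyEq.rfl
      filter_upwards [eventually_gt_atTop 0] with snr hsnr
      rw [hlead i snr hsnr]
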